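/- Let $\mathcal H=L^2(0,1)\times L^2(0,1)$ (complex-valued functions), and let $\tilde L_0$ be the operator in $\mathcal H$ with domain $\mathcal D(\tilde L_0)=\{\mathbf u=(u_1,u_2)\in C^1[0,1]\times C^1[0,1]: u_1(0)=0\}$ given by $$\tilde L_0\mathbf u(\rho)=\begin{pmatrix}-\rho u_1'(\rho)+u_2'(\rho)\\ u_1'(\rho)-\rho u_2'(\rho)\end{pmatrix}.$$ For $k\in\mathbb N_0$ let $$\mathcal H^{2k}=\{\mathbf u\in H^{2k}(0,1)\times H^{2k}(0,1): u_1^{(2j)}(0)=u_2^{(2j+1)}(0)=0 \text{ for all } j\in\mathbb N_0,\ j<k\},$$ equipped with the inner product $(\mathbf u|\mathbf v)_{\mathcal H^{2k}}=(\mathbf u|\mathbf v)_{\mathcal H}+(D^{2k}\mathbf u|D^{2k}\mathbf v)_{\mathcal H}$, where $D^{2k}\mathbf u=(u_1^{(2k)},u_2^{(2k)})$, and the induced norm. Then $\tilde L_0$ is closable, and its closure $L_0$ is the infinitesimal generator of exactly one strongly continuous one-parameter semigroup $S_0:[0,\infty)\to\mathcal B(\mathcal H)$. For every $k\in\mathbb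 N_0$ the space $\mathcal H^{2k}$ is $L_0$-admissible: it is invariant under $S_0(\tau)$ for all $\tau\ge0$, and the restrictions $S_0(\tau)|_{\mathcal H^{2k}}$ are bounded operators on $\mathcal H^{2k}$ that form a strongly continuous semigroup on $\mathcal H^{2k}$ (with respect to the norm of $\mathcal H^{2k}$). Moreover, $$\|S_0(\tau)\mathbf u\|_{\mathcal H^{2k}}\le e^{\frac12\tau}\|\mathbf u\|_{\mathcal H^{2k}}\qquad\text{for all }\mathbf u\in\mathcal H^{2k},\ \tau\ge0.$$ -/

import Mathlib

open MeasureTheory Set Filter Topology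
open scoped NNReal ENNReal ContDiff

noncomputable section

namespace FreeWave

/-! ### Semigroups and generators -/

section Semigroup

variable {X : Type*} [NormedAddCommGroup X] [NormedSpace ℂ X]

/-- `S` is a strongly continuous one-parameter semigroup of bounded linear operators on `X`. -/
structure IsC0Semigroup (S : ℝ≥0 → X →L[ℂ] X) : Prop where
  map_zero : S 0 = ContinuousLinearMap.id ℂ X
  map_add : ∀ s t : ℝ≥0, S (s + t) = (S s).comp (S t)
  strongly_continuous : ∀ x : X, Continuous fun t : ℝ≥0 => S t x

/-- `A` is the infinitesimal generator of `S`: `x ∈ D(A)` and `A x = y` if and only if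
`(S(h) x - x) / h → y` as `h → 0+`. -/
def IsGenerator (A : X →ₗ.[ℂ] X) (S : ℝ≥0 → X →L[ℂ] X) : Prop :=
  ∀ x y : X, (x, y) ∈ A.graph ↔
    Tendsto (fun h : ℝ≥0 => (((h : ℝ) : ℂ)⁻¹) • (S h x - x)) (𝓝[>] 0) (𝓝 y)

end Semigroup

/-! ### The energy space -/

/-- Lebesgue measure on the interval `(0,1)`. -/
abbrev unitMeasure : Measure ℝ := volume.restrict (Ioo (0 : ℝ) 1)

/-- The complex space `L²(0,1)`. -/
abbrev L2 : Type := Lp ℂ 2 unitMeasure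

/-- The Hilbert space `L²(0,1) × L²(0,1)`, with inner product
`(u|v) = (u₁|v₁) + (u₂|v₂)`. -/
abbrev Energy : Type := WithLp 2 (L2 × L2)

/-! ### The operator on `C¹` functions -/

lemma eqOn_of_ae_eq {f g : ℝ → ℂ} (hf : ContinuousOn f (Icc 0 1))
    (hg : ContinuousOn g (Icc 0 1)) (h : f =ᵐ[unitMeasure] g) : EqOn f g (Ioo 0 1) :=
  Measure.eqOn_open_of_ae_eq h isOpen_Ioo (hf.mono Ioo_subset_Icc_self)
    (hg.mono Ioo_subset_Icc_self)

lemma differentiableAt_of_contDiffOn {f : ℝ → ℂ} (hf : ContDiffOn ℝ 1 f (Icc 0 1)) {x : ℝ}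
    (hx : x ∈ Ioo (0 : ℝ) 1) : DifferentiableAt ℝ f x :=
  (hf.differentiableOn one_ne_zero x (Ioo_subset_Icc_self hx)).differentiableAt
    (Icc_mem_nhds hx.1 hx.2)

/-- `(u, v)` lies in the graph of the free operator with representatives `f₁`, `f₂`:
`u = (f₁, f₂)` with `f₁, f₂ ∈ C¹[0,1]`, `f₁(0) = 0`, and
`v(ρ) = (-ρ f₁'(ρ) + f₂'(ρ), f₁'(ρ) - ρ f₂'(ρ))`. -/
structure FreeRel (f₁ f₂ : ℝ → ℂ) (u v : Energy) : Prop where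
  smooth_fst : ContDiffOn ℝ 1 f₁ (Icc 0 1)
  smooth_snd : ContDiffOn ℝ 1 f₂ (Icc 0 1)
  boundary : f₁ 0 = 0
  arg_fst : u.fst =ᵐ[unitMeasure] f₁
  arg_snd : u.snd =ᵐ[unitMeasure] f₂
  val_fst : v.fst =ᵐ[unitMeasure] fun ρ => -(ρ : ℂ) * deriv f₁ ρ + deriv f₂ ρ
  val_snd : v.snd =ᵐ[unitMeasure] fun ρ => deriv f₁ ρ - (ρ : ℂ) * deriv f₂ ρ

/-- The graph of the free operator. -/
def freeGraph : Submodule ℂ (Energy × Energy) where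
  carrier := {p | ∃ f₁ f₂ : ℝ → ℂ, FreeRel f₁ f₂ p.1 p.2}
  zero_mem' := by
    refine ⟨0, 0, contDiffOn_const, contDiffOn_const, rfl, Lp.coeFn_zero _ _ _,
      Lp.coeFn_zero _ _ _, ?_, ?_⟩
    · filter_upwards [Lp.coeFn_zero ℂ 2 unitMeasure] with ρ h
      simpa using h
    · filter_upwards [Lp.coeFn_zero ℂ 2 unitMeasure] with ρ h
      simpa using h
  add_mem' := by
    rintro ⟨u, v⟩ ⟨u', v'⟩ ⟨f₁, f₂, h⟩ ⟨g₁, g₂, h'⟩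
    refine ⟨f₁ + g₁, f₂ + g₂, h.smooth_fst.add h'.smooth_fst, h.smooth_snd.add h'.smooth_snd,
      by simp [h.boundary, h'.boundary], (Lp.coeFn_add _ _).trans (h.arg_fst.add h'.arg_fst),
      (Lp.coeFn_add _ _).trans (h.arg_snd.add h'.arg_snd), ?_, ?_⟩
    · filter_upwards [Lp.coeFn_add v.fst v'.fst, h.val_fst, h'.val_fst,
        ae_restrict_mem measurableSet_Ioo] with ρ h1 h2 h3 hρ
      rw [deriv_add (differentiableAt_of_contDiffOn h.smooth_fst hρ)
        (differentiableAt_of_contDiffOn h'.smooth_fst hρ),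
        deriv_add (differentiableAt_of_contDiffOn h.smooth_snd hρ)
        (differentiableAt_of_contDiffOn h'.smooth_snd hρ)]
      refine h1.trans ?_
      rw [Pi.add_apply, h2, h3]
      ring
    · filter_upwards [Lp.coeFn_add v.snd v'.snd, h.val_snd, h'.val_snd,
        ae_restrict_mem measurableSet_Ioo] with ρ h1 h2 h3 hρ
      rw [deriv_add (differentiableAt_of_contDiffOn h.smooth_fst hρ)
        (differentiableAt_of_contDiffOn h'.smooth_fst hρ),
        deriv_add (differentiableAt_of_contDiffOn h.smooth_snd hρ)
        (differentiableAt_of_contDiffOn h'.smooth_snd hρ)]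
      refine h1.trans ?_
      rw [Pi.add_apply, h2, h3]
      ring
  smul_mem' := by
    rintro c ⟨u, v⟩ ⟨f₁, f₂, h⟩
    refine ⟨c • f₁, c • f₂, h.smooth_fst.const_smul c, h.smooth_snd.const_smul c,
      by simp [h.boundary], (Lp.coeFn_smul _ _).trans (h.arg_fst.const_smul c),
      (Lp.coeFn_smul _ _).trans (h.arg_snd.const_smul c), ?_, ?_⟩
    · filter_upwards [Lp.coeFn_smul c v.fst, h.val_fst,
        ae_restrict_mem measurableSet_Ioo] with ρ h1 h2 hρ
      rw [deriv_const_smul c (differentiableAt_of_contDiffOn h.smooth_fst hρ),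
        deriv_const_smul c (differentiableAt_of_contDiffOn h.smooth_snd hρ)]
      refine h1.trans ?_
      rw [Pi.smul_apply, h2]
      simp only [smul_eq_mul]
      ring
    · filter_upwards [Lp.coeFn_smul c v.snd, h.val_snd,
        ae_restrict_mem measurableSet_Ioo] with ρ h1 h2 hρ
      rw [deriv_const_smul c (differentiableAt_of_contDiffOn h.smooth_fst hρ),
        deriv_const_smul c (differentiableAt_of_contDiffOn h.smooth_snd hρ)]
      refine h1.trans ?_
      rw [Pi.smul_apply, h2]
      simp only [smul_eq_mul]
      ring

lemma freeGraph_functional (p : Energy × Energy) (hp : p ∈ freeGraph) (h0 : p.1 = 0) :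
    p.2 = 0 := by
  obtain ⟨u, v⟩ := p
  obtain ⟨f₁, f₂, h⟩ := hp
  obtain rfl : u = 0 := h0
  have key : ∀ f : ℝ → ℂ, ContDiffOn ℝ 1 f (Icc 0 1) →
      ((0 : L2) : ℝ → ℂ) =ᵐ[unitMeasure] f → ∀ x ∈ Ioo (0 : ℝ) 1, deriv f x = 0 := by
    intro f hf hae x hx
    have heq : EqOn f (fun _ => (0 : ℂ)) (Ioo 0 1) :=
      eqOn_of_ae_eq hf.continuousOn continuousOn_const
        (hae.symm.trans (Lp.coeFn_zero ℂ 2 unitMeasure))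
    have hev : f =ᶠ[𝓝 x] fun _ => (0 : ℂ) := heq.eventuallyEq_of_mem (Ioo_mem_nhds hx.1 hx.2)
    rw [hev.deriv_eq]
    simp
  have k1 := key f₁ h.smooth_fst h.arg_fst
  have k2 := key f₂ h.smooth_snd h.arg_snd
  have e1 : v.fst = 0 := by
    refine Lp.ext ?_
    filter_upwards [h.val_fst, Lp.coeFn_zero ℂ 2 unitMeasure,
      ae_restrict_mem measurableSet_Ioo] with ρ h1 h2 hρ
    rw [h1, h2, k1 ρ hρ, k2 ρ hρ]
    simp
  have e2 : v.snd = 0 := by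
    refine Lp.ext ?_
    filter_upwards [h.val_snd, Lp.coeFn_zero ℂ 2 unitMeasure,
      ae_restrict_mem measurableSet_Ioo] with ρ h1 h2 hρ
    rw [h1, h2, k1 ρ hρ, k2 ρ hρ]
    simp
  exact WithLp.ofLp_injective 2 (Prod.ext e1 e2)

/-- The unbounded operator with domain `{u ∈ C¹[0,1] × C¹[0,1] : u₁(0) = 0}` acting by
`u ↦ (-ρ u₁' + u₂', u₁' - ρ u₂')`. -/
def freeOperator : Energy →ₗ.[ℂ] Energy := freeGraph.toLinearPMap

lemma freeOperator_graph : freeOperator.graph = freeGraph :=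
  Submodule.toLinearPMap_graph_eq _ freeGraph_functional

/-! ### Weak derivatives and the spaces `H²ᵏ` -/

/-- `g` is the weak derivative of order `n` of `f` on `(0,1)`. -/
def IsWeakDeriv (n : ℕ) (f g : L2) : Prop :=
  ∀ φ : ℝ → ℝ, ContDiff ℝ ∞ φ → HasCompactSupport φ → tsupport φ ⊆ Ioo 0 1 →
    ∫ x in Ioo (0 : ℝ) 1, iteratedDeriv n φ x • f x =
      (-1 : ℂ) ^ n * ∫ x in Ioo (0 : ℝ) 1, φ x • g x

/-- `f` belongs to the Sobolev space `H^m(0,1)`: all weak derivatives up to order `m`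
exist in `L²(0,1)`. -/
def MemSobolev (m : ℕ) (f : L2) : Prop := ∀ n ≤ m, ∃ g : L2, IsWeakDeriv n f g

/-- `f⁽ⁿ⁾(0) = 0`: the weak derivative of order `n` of `f` has a representative that is
continuous on `[0,1]` and vanishes at `0`. -/
def DerivVanishesAtZero (n : ℕ) (f : L2) : Prop :=
  ∃ g : L2, IsWeakDeriv n f g ∧
    ∃ h : ℝ → ℂ, ContinuousOn h (Icc 0 1) ∧ g =ᵐ[unitMeasure] h ∧ h 0 = 0

lemma integrable_smul_Lp {φ : ℝ → ℝ} (hφ : Continuous φ) (hc : HasCompactSupport φ) (f : L2) :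
    Integrable (fun x => φ x • f x) unitMeasure := by
  have h : Integrable f unitMeasure := (Lp.memLp f).integrable (by norm_num)
  obtain ⟨C, hC⟩ := hφ.bounded_above_of_compact_support hc
  exact h.bdd_smul C hφ.aestronglyMeasurable (Eventually.of_forall hC)

lemma continuous_iteratedDeriv {φ : ℝ → ℝ} (hφ : ContDiff ℝ ∞ φ) (n : ℕ) :
    Continuous (iteratedDeriv n φ) :=
  hφ.continuous_iteratedDeriv n (by exact_mod_cast le_top)

lemma hasCompactSupport_iteratedDeriv {φ : ℝ → ℝ} (hc : HasCompactSupport φ) (n : ℕ) :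
    HasCompactSupport (iteratedDeriv n φ) := by
  induction n with
  | zero => simpa using hc
  | succ n ih => rw [iteratedDeriv_succ]; exact ih.deriv

lemma integral_smul_add {φ : ℝ → ℝ} (hφ : Continuous φ) (hc : HasCompactSupport φ) (f g : L2) :
    ∫ x in Ioo (0 : ℝ) 1, φ x • (f + g) x =
      (∫ x in Ioo (0 : ℝ) 1, φ x • f x) + ∫ x in Ioo (0 : ℝ) 1, φ x • g x := by
  rw [← integral_add (integrable_smul_Lp hφ hc f) (integrable_smul_Lp hφ hc g)]
  refine integral_congr_ae ?_
  filter_upwards [Lp.coeFn_add f g] with x hx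
  rw [hx, Pi.add_apply, smul_add]

lemma integral_smul_smul (φ : ℝ → ℝ) (c : ℂ) (f : L2) :
    ∫ x in Ioo (0 : ℝ) 1, φ x • (c • f) x = c * ∫ x in Ioo (0 : ℝ) 1, φ x • f x := by
  rw [← integral_const_mul]
  refine integral_congr_ae ?_
  filter_upwards [Lp.coeFn_smul c f] with x hx
  rw [hx, Pi.smul_apply, smul_comm, smul_eq_mul]

lemma IsWeakDeriv.add {n : ℕ} {f g f' g' : L2} (h : IsWeakDeriv n f g)
    (h' : IsWeakDeriv n f' g') : IsWeakDeriv n (f + f') (g + g') := by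
  intro φ hφ hc hs
  rw [integral_smul_add (continuous_iteratedDeriv hφ n) (hasCompactSupport_iteratedDeriv hc n),
    integral_smul_add hφ.continuous hc, h φ hφ hc hs, h' φ hφ hc hs, mul_add]

lemma IsWeakDeriv.smul {n : ℕ} {f g : L2} (c : ℂ) (h : IsWeakDeriv n f g) :
    IsWeakDeriv n (c • f) (c • g) := by
  intro φ hφ hc hs
  rw [integral_smul_smul, integral_smul_smul, h φ hφ hc hs]
  ring

lemma isWeakDeriv_zero (n : ℕ) : IsWeakDeriv n 0 0 := by
  intro φ _ _ _
  have h0 : ∀ ψ : ℝ → ℝ, ∫ x in Ioo (0 : ℝ) 1, ψ x • (0 : L2) x = 0 := by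
    intro ψ
    simpa using integral_smul_smul ψ 0 0
  rw [h0, h0, mul_zero]

lemma IsWeakDeriv.unique {n : ℕ} {f g g' : L2} (h : IsWeakDeriv n f g)
    (h' : IsWeakDeriv n f g') : g = g' := by
  have hd : IsWeakDeriv n 0 (g + (-1 : ℂ) • g') := by
    have := h.add (h'.smul (-1))
    simpa using this
  have key : ∀ᵐ x : ℝ, x ∈ Ioo (0 : ℝ) 1 → (g + (-1 : ℂ) • g' : L2) x = 0 := by
    refine isOpen_Ioo.ae_eq_zero_of_integral_contDiff_smul_eq_zero ?_ ?_
    · have hi : IntegrableOn (g + (-1 : ℂ) • g' : L2) (Ioo (0 : ℝ) 1) :=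
        (Lp.memLp (g + (-1 : ℂ) • g')).integrable (by norm_num)
      exact hi.locallyIntegrableOn
    · intro φ hφ hc hs
      have h1 := hd φ hφ hc hs
      have h0 : ∫ x in Ioo (0 : ℝ) 1, iteratedDeriv n φ x • (0 : L2) x = 0 := by
        simpa using integral_smul_smul (iteratedDeriv n φ) 0 0
      rw [h0] at h1
      have h2 : ∫ x in Ioo (0 : ℝ) 1, φ x • (g + (-1 : ℂ) • g' : L2) x = 0 := by
        rcases mul_eq_zero.mp h1.symm with h3 | h3
        · exact absurd h3 (pow_ne_zero _ (by norm_num))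
        · exact h3
      rw [← h2]
      refine (setIntegral_eq_integral_of_forall_compl_eq_zero ?_).symm
      intro x hx
      rw [image_eq_zero_of_notMem_tsupport (fun hx' => hx (hs hx')), zero_smul]
  have hz : (g + (-1 : ℂ) • g' : L2) = 0 := by
    refine Lp.ext ?_
    filter_upwards [(ae_restrict_iff' measurableSet_Ioo).mpr key,
      Lp.coeFn_zero ℂ 2 unitMeasure] with x hx h0
    rw [hx, h0]
    rfl
  rw [neg_one_smul, ← sub_eq_add_neg] at hz
  exact sub_eq_zero.mp hz

/-- The space `H²ᵏ` as a subspace of the energy space: both components lie in `H^{2k}(0,1)`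
and `u₁⁽²ʲ⁾(0) = u₂⁽²ʲ⁺¹⁾(0) = 0` for `j < k`. -/
def sobolevSubmodule (k : ℕ) : Submodule ℂ Energy where
  carrier := {u | MemSobolev (2 * k) u.fst ∧ MemSobolev (2 * k) u.snd ∧
    ∀ j < k, DerivVanishesAtZero (2 * j) u.fst ∧ DerivVanishesAtZero (2 * j + 1) u.snd}
  zero_mem' := by
    have hv : ∀ n, DerivVanishesAtZero n 0 := fun n =>
      ⟨0, isWeakDeriv_zero n, 0, continuousOn_const, Lp.coeFn_zero _ _ _, rfl⟩
    exact ⟨fun n _ => ⟨0, isWeakDeriv_zero n⟩, fun n _ => ⟨0, isWeakDeriv_zero n⟩,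
      fun j _ => ⟨hv _, hv _⟩⟩
  add_mem' := by
    have hm : ∀ {m : ℕ} {f g : L2}, MemSobolev m f → MemSobolev m g → MemSobolev m (f + g) := by
      intro m f g hf hg n hn
      obtain ⟨a, ha⟩ := hf n hn
      obtain ⟨b, hb⟩ := hg n hn
      exact ⟨a + b, ha.add hb⟩
    have hv : ∀ {n : ℕ} {f g : L2}, DerivVanishesAtZero n f → DerivVanishesAtZero n g →
        DerivVanishesAtZero n (f + g) := by
      rintro n f g ⟨a, ha, p, hp, hap, hp0⟩ ⟨b, hb, q, hq, hbq, hq0⟩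
      exact ⟨a + b, ha.add hb, p + q, hp.add hq, (Lp.coeFn_add _ _).trans (hap.add hbq),
        by simp [hp0, hq0]⟩
    rintro u v ⟨h1, h2, h3⟩ ⟨h1', h2', h3'⟩
    exact ⟨hm h1 h1', hm h2 h2',
      fun j hj => ⟨hv (h3 j hj).1 (h3' j hj).1, hv (h3 j hj).2 (h3' j hj).2⟩⟩
  smul_mem' := by
    have hm : ∀ {m : ℕ} (c : ℂ) {f : L2}, MemSobolev m f → MemSobolev m (c • f) := by
      intro m c f hf n hn
      obtain ⟨a, ha⟩ := hf n hn
      exact ⟨c • a, ha.smul c⟩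
    have hv : ∀ {n : ℕ} (c : ℂ) {f : L2}, DerivVanishesAtZero n f →
        DerivVanishesAtZero n (c • f) := by
      rintro n c f ⟨a, ha, p, hp, hap, hp0⟩
      exact ⟨c • a, ha.smul c, c • p, hp.const_smul c,
        (Lp.coeFn_smul _ _).trans (hap.const_smul c), by simp [hp0]⟩
    rintro c u ⟨h1, h2, h3⟩
    exact ⟨hm c h1, hm c h2, fun j hj => ⟨hv c (h3 j hj).1, hv c (h3 j hj).2⟩⟩

/-- The space `H²ᵏ` as a type of its own, so that it can carry its own inner product rather than
the one inherited from the energy space. -/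
def SobolevSpace (k : ℕ) : Type := sobolevSubmodule k

namespace SobolevSpace

variable {k : ℕ}

instance : AddCommGroup (SobolevSpace k) := inferInstanceAs (AddCommGroup (sobolevSubmodule k))

instance : Module ℂ (SobolevSpace k) := inferInstanceAs (Module ℂ (sobolevSubmodule k))

/-- The inclusion of `H²ᵏ` into the energy space. -/
def incl (k : ℕ) : SobolevSpace k →ₗ[ℂ] Energy := (sobolevSubmodule k).subtype

lemma incl_injective : Function.Injective (incl k) := Subtype.val_injective

lemma incl_mem (u : SobolevSpace k) : incl k u ∈ sobolevSubmodule k := Subtype.property u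

lemma exists_top (u : SobolevSpace k) :
    ∃ v : Energy, IsWeakDeriv (2 * k) (incl k u).fst v.fst ∧
      IsWeakDeriv (2 * k) (incl k u).snd v.snd := by
  obtain ⟨a, ha⟩ := (incl_mem u).1 (2 * k) le_rfl
  obtain ⟨b, hb⟩ := (incl_mem u).2.1 (2 * k) le_rfl
  exact ⟨WithLp.toLp 2 (a, b), ha, hb⟩

/-- `D²ᵏ u`: the componentwise weak derivative of order `2k`. -/
def topDeriv (u : SobolevSpace k) : Energy := (exists_top u).choose

lemma topDeriv_spec (u : SobolevSpace k) :
    IsWeakDeriv (2 * k) (incl k u).fst (topDeriv u).fst ∧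
      IsWeakDeriv (2 * k) (incl k u).snd (topDeriv u).snd := (exists_top u).choose_spec

lemma topDeriv_eq {u : SobolevSpace k} {v : Energy}
    (h1 : IsWeakDeriv (2 * k) (incl k u).fst v.fst)
    (h2 : IsWeakDeriv (2 * k) (incl k u).snd v.snd) : topDeriv u = v :=
  WithLp.ofLp_injective 2
    (Prod.ext ((topDeriv_spec u).1.unique h1) ((topDeriv_spec u).2.unique h2))

lemma topDeriv_add (u v : SobolevSpace k) : topDeriv (u + v) = topDeriv u + topDeriv v :=
  topDeriv_eq ((topDeriv_spec u).1.add (topDeriv_spec v).1)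
    ((topDeriv_spec u).2.add (topDeriv_spec v).2)

lemma topDeriv_smul (c : ℂ) (u : SobolevSpace k) : topDeriv (c • u) = c • topDeriv u :=
  topDeriv_eq ((topDeriv_spec u).1.smul c) ((topDeriv_spec u).2.smul c)

/-- The inner product `(u|v) + (D²ᵏ u|D²ᵏ v)` on `H²ᵏ`. -/
@[reducible]
def core (k : ℕ) : InnerProductSpace.Core ℂ (SobolevSpace k) where
  inner u v := inner ℂ (incl k u) (incl k v) + inner ℂ (topDeriv u) (topDeriv v)
  conj_inner_symm u v := by
    rw [map_add, inner_conj_symm, inner_conj_symm]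
  re_inner_nonneg u := by
    rw [map_add]
    exact add_nonneg inner_self_nonneg inner_self_nonneg
  add_left u v w := by
    rw [map_add, topDeriv_add, inner_add_left, inner_add_left]
    ring
  smul_left u v c := by
    rw [map_smul, topDeriv_smul, inner_smul_left, inner_smul_left]
    ring
  definite u h := by
    have h' := congrArg RCLike.re h
    rw [map_add, inner_self_eq_norm_sq, inner_self_eq_norm_sq, map_zero] at h'
    have h0 : ‖incl k u‖ = 0 := by nlinarith [sq_nonneg ‖incl k u‖, sq_nonneg ‖topDeriv u‖]
    exact incl_injective ((norm_eq_zero.mp h0).trans (map_zero (incl k)).symm)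

instance : NormedAddCommGroup (SobolevSpace k) := (core k).toNormedAddCommGroup

instance : InnerProductSpace ℂ (SobolevSpace k) := InnerProductSpace.ofCore (core k).toCore

end SobolevSpace

end FreeWave

end

open FreeWave

noncomputable section

namespace FreeWave

/-! Glue the two components into one function on `(-1,1)`: let `w` have odd part `u₁` and even part
`u₂`, so that `w = u₁ + u₂` on `(0,1)`. Adding the components of the operator, and subtracting them
at the reflected point, turns it into the scalar transport operator `w ↦ (1 - x) w'`. Its
characteristics are `flow t x = 1 - (1 - x)e^{-t}`; they map `(-1,1)` into itself, so no condition
is needed at the outer boundary, and the semigroup is explicit: `w ↦ w ∘ flow t`. With half of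
Lebesgue measure on `(-1,1)` the gluing is unitary (`foldEquiv`), and since the flow contracts
lengths by `e^{-t}`, composition has norm at most `e^{t/2}`.

The generator is identified with the closure in two halves. The condition `u₁(0) = 0` makes the
glued function Lipschitz, so the difference quotients converge by bounded convergence
(`hasGenerator_of_mem_freeGraph`). Conversely, smooth functions on the line restrict to a dense set
whose orbits stay in the graph (`exists_dense_core`), and averaging orbits in time then puts every
generator pair into the closed graph (`HasGenerator.mem_of_dense`). Closability follows because
generators are single valued, uniqueness from `HasGenerator.orbit_eq`.

In `H²ᵏ` the boundary conditions say exactly that the glued function and its derivatives of order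
below `2k` have no jump at zero. Weak derivatives are handled as chains of primitives
(`IsDerivChain`), which survive gluing, composition with the affine flow and folding back. Each
derivative costs a factor `e^{-t}`, whence `D²ᵏ S(t) = e^{-2kt} S(t) D²ᵏ` (`topDeriv_evolve`). The
extra factor is at most one, so both parts of the norm obey the bound `e^{t/2}`. -/

/-! ### Generators of strongly continuous semigroups -/

section AbstractSemigroup

variable {X : Type*} [NormedAddCommGroup X] [NormedSpace ℂ X] {S S' : ℝ≥0 → X →L[ℂ] X}

/-- The difference quotients of the orbit of `x` at time zero converge to `y`. -/
def HasGenerator (S : ℝ≥0 → X →L[ℂ] X) (x y : X) : Prop :=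
  Tendsto (fun h : ℝ≥0 => (((h : ℝ) : ℂ)⁻¹) • (S h x - x)) (𝓝[>] 0) (𝓝 y)

lemma tendsto_toNNReal_nhdsGT_zero : Tendsto Real.toNNReal (𝓝[>] (0 : ℝ)) (𝓝[>] (0 : ℝ≥0)) := by
  refine tendsto_nhdsWithin_iff.mpr ⟨?_, ?_⟩
  · have := (continuous_real_toNNReal.tendsto 0).mono_left (nhdsWithin_le_nhds (s := Ioi (0 : ℝ)))
    simpa using this
  · filter_upwards [self_mem_nhdsWithin] with x hx
    exact Real.toNNReal_pos.mpr hx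

lemma tendsto_coe_nhdsGT_zero : Tendsto ((↑) : ℝ≥0 → ℝ) (𝓝[>] (0 : ℝ≥0)) (𝓝[>] (0 : ℝ)) := by
  refine tendsto_nhdsWithin_iff.mpr ⟨?_, ?_⟩
  · have := (NNReal.continuous_coe.tendsto 0).mono_left (nhdsWithin_le_nhds (s := Ioi (0 : ℝ≥0)))
    simpa using this
  · filter_upwards [self_mem_nhdsWithin] with x hx
    exact NNReal.coe_pos.mpr hx

lemma HasGenerator.unique {x y y' : X} (h : HasGenerator S x y) (h' : HasGenerator S x y') :
    y = y' :=
  have : (𝓝[>] (0 : ℝ≥0)).NeBot :=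
    tendsto_toNNReal_nhdsGT_zero.neBot
  tendsto_nhds_unique h h'

lemma HasGenerator.tendsto_real {x y : X} (h : HasGenerator S x y) :
    Tendsto (fun h : ℝ => h⁻¹ • (S h.toNNReal x - x)) (𝓝[>] 0) (𝓝 y) := by
  refine (h.comp tendsto_toNNReal_nhdsGT_zero).congr' ?_
  filter_upwards [self_mem_nhdsWithin] with t ht
  have ht' : (0 : ℝ) ≤ t := le_of_lt ht
  simp only [Function.comp, Real.coe_toNNReal t ht']
  rw [← Complex.ofReal_inv, Complex.coe_smul]

lemma HasGenerator.map (hS : IsC0Semigroup S) {x y : X} (h : HasGenerator S x y) (t : ℝ≥0) :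
    HasGenerator S (S t x) (S t y) := by
  refine (((S t).continuous.tendsto y).comp h).congr fun s => ?_
  simp only [Function.comp, map_smul, map_sub]
  rw [← ContinuousLinearMap.comp_apply, ← hS.map_add, ← ContinuousLinearMap.comp_apply,
    ← hS.map_add, add_comm]

lemma IsC0Semigroup.continuous_orbit (hS : IsC0Semigroup S) (x : X) :
    Continuous fun s : ℝ => S s.toNNReal x :=
  (hS.strongly_continuous x).comp continuous_real_toNNReal

lemma IsC0Semigroup.orbit_sub (hS : IsC0Semigroup S) (x : X) {s r : ℝ} (hs : 0 ≤ s) (hr : s ≤ r) :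
    S r.toNNReal x = S (r - s).toNNReal (S s.toNNReal x) := by
  rw [← ContinuousLinearMap.comp_apply, ← hS.map_add,
    ← Real.toNNReal_add (sub_nonneg.mpr hr) hs, sub_add_cancel]

/-- The generator only controls forward difference quotients. A right derivative is nevertheless
enough for the fundamental theorem of calculus and for the constancy criterion, because orbits are
continuous. -/
lemma HasGenerator.hasDerivWithinAt (hS : IsC0Semigroup S) {x y : X} (h : HasGenerator S x y)
    {s : ℝ} (hs : 0 ≤ s) :
    HasDerivWithinAt (fun r : ℝ => S r.toNNReal x) (S s.toNNReal y) (Ioi s) s := by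
  rw [hasDerivWithinAt_iff_tendsto_slope' self_notMem_Ioi]
  have h1 := (h.map hS s.toNNReal).tendsto_real
  have h2 : Tendsto (fun r : ℝ => r - s) (𝓝[>] s) (𝓝[>] 0) := by
    refine tendsto_nhdsWithin_iff.mpr ⟨?_, ?_⟩
    · have : Tendsto (fun r : ℝ => r - s) (𝓝 s) (𝓝 (s - s)) :=
        (continuous_id.sub continuous_const).tendsto s
      rw [sub_self] at this
      exact this.mono_left nhdsWithin_le_nhds
    · filter_upwards [self_mem_nhdsWithin] with r hr
      exact sub_pos.mpr (mem_Ioi.mp hr)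
  refine (h1.comp h2).congr' ?_
  filter_upwards [self_mem_nhdsWithin] with r hr
  simp only [Function.comp, slope, vsub_eq_sub]
  rw [hS.orbit_sub x hs (le_of_lt hr)]

/-- A strongly continuous semigroup with a bound `‖S t‖ ≤ e^{ct}` integrates continuously. -/
lemma continuous_integral_orbit (hS : IsC0Semigroup S) {c : ℝ}
    (hb : ∀ (t : ℝ≥0) x, ‖S t x‖ ≤ Real.exp (c * t) * ‖x‖) {t : ℝ} (ht : 0 ≤ t) :
    Continuous fun x : X => ∫ s in 0..t, S s.toNNReal x := by
  let L : X →ₗ[ℝ] X :=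
    { toFun := fun x => ∫ s in 0..t, S s.toNNReal x
      map_add' := fun x y => by
        simp only [map_add]
        exact intervalIntegral.integral_add ((hS.continuous_orbit x).intervalIntegrable _ _)
          ((hS.continuous_orbit y).intervalIntegrable _ _)
      map_smul' := fun a x => by
        simp only [RingHom.id_apply]
        rw [← intervalIntegral.integral_smul]
        refine intervalIntegral.integral_congr fun s _ => ?_
        change S s.toNNReal (a • x) = a • S s.toNNReal x
        rw [← Complex.coe_smul, map_smul, Complex.coe_smul] }
  -- The absolute value `|c|` gives a bound uniform on `[0,t]` whatever the sign of `c`.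
  refine (L.mkContinuous (Real.exp (|c| * t) * |t - 0|) fun x => ?_).continuous
  have := intervalIntegral.norm_integral_le_of_norm_le_const (a := 0) (b := t)
    (f := fun s => S s.toNNReal x) (C := Real.exp (|c| * t) * ‖x‖) ?_
  · refine this.trans (le_of_eq (by ring))
  · intro s hs
    rw [uIoc_of_le ht] at hs
    refine (hb _ x).trans ?_
    rw [Real.coe_toNNReal s hs.1.le]
    gcongr
    · exact hs.1.le
    · exact le_abs_self c
    · exact hs.2

/-- Joint continuity: split `v i = v₀ + (v i - v₀)`. Strong continuity treats the first term, and
the locally uniform operator bound kills the second. -/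
lemma IsC0Semigroup.tendsto_apply (hS : IsC0Semigroup S) {c : ℝ}
    (hb : ∀ (t : ℝ≥0) x, ‖S t x‖ ≤ Real.exp (c * t) * ‖x‖) {ι : Type*} {l : Filter ι}
    {a : ι → ℝ≥0} {a₀ : ℝ≥0} {v : ι → X} {v₀ : X} (ha : Tendsto a l (𝓝 a₀))
    (hv : Tendsto v l (𝓝 v₀)) : Tendsto (fun i => S (a i) (v i)) l (𝓝 (S a₀ v₀)) := by
  have h1 : Tendsto (fun i => S (a i) v₀) l (𝓝 (S a₀ v₀)) :=
    ((hS.strongly_continuous v₀).tendsto a₀).comp ha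
  have h2 : Tendsto (fun i => S (a i) (v i - v₀)) l (𝓝 0) := by
    have h3 : Tendsto (fun i => Real.exp (c * a i) * ‖v i - v₀‖) l (𝓝 0) := by
      have h4 : Tendsto (fun i => Real.exp (c * a i)) l (𝓝 (Real.exp (c * a₀))) :=
        ((by fun_prop : Continuous fun b : ℝ≥0 => Real.exp (c * b)).tendsto a₀).comp ha
      simpa using h4.mul (tendsto_iff_norm_sub_tendsto_zero.mp hv)
    exact squeeze_zero_norm (fun i => hb _ _) h3
  simpa using h1.add h2

/-- Two semigroups agree on the common part of the domains of their generators. -/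
lemma HasGenerator.orbit_eq (hS : IsC0Semigroup S) (hS' : IsC0Semigroup S') {c : ℝ}
    (hb : ∀ (t : ℝ≥0) x, ‖S t x‖ ≤ Real.exp (c * t) * ‖x‖)
    (hgen : ∀ x y, HasGenerator S' x y → HasGenerator S x y)
    {x y : X} (h : HasGenerator S' x y) (t : ℝ≥0) : S' t x = S t x := by
  have hsub : ∀ s : ℝ, Tendsto (fun r : ℝ => ((t : ℝ) - r).toNNReal) (𝓝 s)
      (𝓝 ((t : ℝ) - s).toNNReal) := fun s =>
    (continuous_real_toNNReal.comp (continuous_const.sub continuous_id)).tendsto s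
  -- The function `s ↦ S(t-s) S'(s) x` joins `S(t) x` to `S'(t) x`; it suffices that its right
  -- derivative vanishes.
  have hconst := constant_of_has_deriv_right_zero (a := 0) (b := (t : ℝ))
    (f := fun s : ℝ => S ((t : ℝ) - s).toNNReal (S' s.toNNReal x)) ?_ ?_ t ⟨t.2, le_rfl⟩
  · simpa [hS.map_zero, hS'.map_zero] using hconst
  · refine Continuous.continuousOn (continuous_iff_continuousAt.mpr fun s => ?_)
    exact hS.tendsto_apply hb (hsub s) ((hS'.continuous_orbit x).tendsto s)
  · rintro s ⟨hs0, hst⟩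
    refine HasDerivWithinAt.Ici_of_Ioi ?_
    rw [hasDerivWithinAt_iff_tendsto_slope' self_notMem_Ioi]
    have h1 := (hasDerivWithinAt_iff_tendsto_slope' self_notMem_Ioi).mp
      (h.hasDerivWithinAt hS' hs0)
    have h2 := (hasDerivWithinAt_iff_tendsto_slope' self_notMem_Ioi).mp
      ((hgen _ _ (h.map hS' s.toNNReal)).hasDerivWithinAt hS le_rfl)
    have h3 : Tendsto (fun r : ℝ => r - s) (𝓝[>] s) (𝓝[>] 0) := by
      refine tendsto_nhdsWithin_iff.mpr ⟨?_, ?_⟩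
      · have : Tendsto (fun r : ℝ => r - s) (𝓝 s) (𝓝 (s - s)) :=
          (continuous_id.sub continuous_const).tendsto s
        rw [sub_self] at this
        exact this.mono_left nhdsWithin_le_nhds
      · filter_upwards [self_mem_nhdsWithin] with r hr
        exact sub_pos.mpr (mem_Ioi.mp hr)
    -- The quotient of the interpolating function is `S(t-r)` applied to the quotient of `S'` minus
    -- that of `S`, both started at `S'(s) x`. By `hgen` both tend to `S'(s) y`.
    have h4 := hS.tendsto_apply hb ((hsub s).mono_left nhdsWithin_le_nhds)
      (h1.sub (h2.comp h3))
    simp only [Real.toNNReal_zero, hS.map_zero, ContinuousLinearMap.id_apply, sub_self,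
      map_zero] at h4
    refine h4.congr' ?_
    filter_upwards [Ioo_mem_nhdsGT hst] with r hr
    have hr1 : 0 ≤ r - s := sub_nonneg.mpr hr.1.le
    have e1 : ((t : ℝ) - s).toNNReal = ((t : ℝ) - r).toNNReal + (r - s).toNNReal := by
      rw [← Real.toNNReal_add (sub_nonneg.mpr hr.2.le) hr1]
      congr 1
      ring
    have e2 : ∀ (a : ℝ) (b : ℝ≥0) (z : X), S b (a • z) = a • S b z := fun a b z => by
      rw [← Complex.coe_smul, map_smul, Complex.coe_smul]
    simp only [Function.comp, slope, vsub_eq_sub, sub_zero, Real.toNNReal_zero, hS.map_zero,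
      ContinuousLinearMap.id_apply]
    rw [← smul_sub, sub_sub_sub_cancel_right, e2, e1, hS.map_add, map_sub]
    rfl

/-! ### Integral form of the generator and invariant cores. -/

variable [CompleteSpace X]

lemma HasGenerator.sub_eq_integral (hS : IsC0Semigroup S) {x y : X} (h : HasGenerator S x y)
    {t : ℝ} (ht : 0 ≤ t) : S t.toNNReal x - x = ∫ s in 0..t, S s.toNNReal y := by
  rw [intervalIntegral.integral_eq_sub_of_hasDeriv_right_of_le ht
    (hS.continuous_orbit x).continuousOn (fun s hs => h.hasDerivWithinAt hS hs.1.le)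
    ((hS.continuous_orbit y).intervalIntegrable _ _)]
  simp [hS.map_zero]

lemma IsC0Semigroup.tendsto_average (hS : IsC0Semigroup S) (y : X) :
    Tendsto (fun h : ℝ => h⁻¹ • ∫ s in 0..h, S s.toNNReal y) (𝓝[>] 0) (𝓝 y) := by
  have h1 : HasDerivAt (fun h : ℝ => ∫ s in 0..h, S s.toNNReal y) (S (0 : ℝ).toNNReal y) 0 :=
    (hS.continuous_orbit y).integral_hasStrictDerivAt 0 0 |>.hasDerivAt
  have h2 := (hasDerivWithinAt_iff_tendsto_slope' self_notMem_Ioi).mp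
    (h1.hasDerivWithinAt (s := Ioi 0))
  simpa [slope_fun_def, hS.map_zero] using h2

lemma hasGenerator_of_integral (hS : IsC0Semigroup S) {x y : X}
    (h : ∀ t : ℝ, 0 ≤ t → S t.toNNReal x - x = ∫ s in 0..t, S s.toNNReal y) :
    HasGenerator S x y := by
  refine ((hS.tendsto_average y).comp tendsto_coe_nhdsGT_zero).congr fun t => ?_
  simp only [Function.comp]
  rw [← h t t.2, Real.toNNReal_coe, ← Complex.ofReal_inv, Complex.coe_smul]

/-- The pairs are characterised by `S(t)x - x = ∫₀ᵗ S(s)y ds` for all `t ≥ 0`, and for fixed `t`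
both sides are continuous in `(x, y)`. -/
lemma isClosed_setOf_hasGenerator (hS : IsC0Semigroup S) {c : ℝ}
    (hb : ∀ (t : ℝ≥0) x, ‖S t x‖ ≤ Real.exp (c * t) * ‖x‖) :
    IsClosed {p : X × X | HasGenerator S p.1 p.2} := by
  have : {p : X × X | HasGenerator S p.1 p.2} =
      ⋂ (t : ℝ) (_ : 0 ≤ t), {p | S t.toNNReal p.1 - p.1 = ∫ s in 0..t, S s.toNNReal p.2} := by
    ext p
    simp only [mem_ofPred_eq, mem_iInter]
    exact ⟨fun h t ht => h.sub_eq_integral hS ht, fun h => hasGenerator_of_integral hS h⟩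
  rw [this]
  refine isClosed_iInter fun t => isClosed_iInter fun ht => isClosed_eq ?_ ?_
  · exact ((S _).continuous.comp continuous_fst).sub continuous_fst
  · exact (continuous_integral_orbit hS hb ht).comp continuous_snd

/-- A closed subspace of `X × X` that contains the orbits of a dense set of generator pairs
contains all generator pairs. -/
lemma HasGenerator.mem_of_dense (hS : IsC0Semigroup S) {c : ℝ}
    (hb : ∀ (t : ℝ≥0) x, ‖S t x‖ ≤ Real.exp (c * t) * ‖x‖) {G : Submodule ℂ (X × X)}
    (hG : IsClosed (G : Set (X × X))) {D : Set X} (hD : Dense D)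
    (hDG : ∀ x ∈ D, ∃ y, HasGenerator S x y ∧ ∀ t, (S t x, S t y) ∈ G)
    {x y : X} (h : HasGenerator S x y) : (x, y) ∈ G := by
  -- Integrated pairs make sense for every `z`, not only for `z` in the domain, so membership in `G`
  -- passes from `D` to all of `X` by density. Dividing by `t` and letting `t → 0` then recovers
  -- `(x, y)`.
  have key : ∀ t : ℝ, 0 ≤ t → ∀ z : X, (∫ s in 0..t, S s.toNNReal z, S t.toNNReal z - z) ∈ G := by
    intro t ht
    have hc : IsClosed {z : X | (∫ s in 0..t, S s.toNNReal z, S t.toNNReal z - z) ∈ G} :=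
      hG.preimage ((continuous_integral_orbit hS hb ht).prodMk
        ((S _).continuous.sub continuous_id))
    have hsub : D ⊆ {z : X | (∫ s in 0..t, S s.toNNReal z, S t.toNNReal z - z) ∈ G} := by
      intro z hz
      obtain ⟨w, hw, hzw⟩ := hDG z hz
      have hint : ∫ s in 0..t, (S s.toNNReal z, S s.toNNReal w) ∈ G := by
        have hcont : Continuous fun s : ℝ => (S s.toNNReal z, S s.toNNReal w) :=
          (hS.continuous_orbit z).prodMk (hS.continuous_orbit w)
        have hconv : Convex ℝ (G : Set (X × X)) := (G.restrictScalars ℝ).convex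
        rw [intervalIntegral.integral_of_le ht]
        rcases ht.eq_or_lt with rfl | ht0
        · simp
        have hv : volume (Ioc (0 : ℝ) t) ≠ 0 := by simp [ht0]
        have hv' : volume (Ioc (0 : ℝ) t) ≠ ⊤ := by simp
        -- The time average of the orbit stays in the closed convex set `G`; multiplying by the
        -- length of the interval restores the integral.
        have := hconv.set_average_mem hG hv hv' (Eventually.of_forall fun s => hzw s.toNNReal)
          (hcont.integrableOn_Ioc)
        rw [setAverage_eq] at this
        have h3 := (G.restrictScalars ℝ).smul_mem (volume.real (Ioc (0 : ℝ) t)) this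
        rw [smul_inv_smul₀] at h3
        · exact h3
        · simp [Measure.real, ht0.le, ht0.ne']
      have hpair : ∫ s in 0..t, (S s.toNNReal z, S s.toNNReal w) =
          (∫ s in 0..t, S s.toNNReal z, ∫ s in 0..t, S s.toNNReal w) := by
        simp only [intervalIntegral.integral_of_le ht]
        exact integral_pair (hS.continuous_orbit z).integrableOn_Ioc
          (hS.continuous_orbit w).integrableOn_Ioc
      change (_, _) ∈ G
      rw [hw.sub_eq_integral hS ht, ← hpair]
      exact hint
    intro z
    exact hc.closure_subset_iff.mpr hsub (hD z)
  have hlim : Tendsto (fun t : ℝ => (t⁻¹ • ∫ s in 0..t, S s.toNNReal x,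
      t⁻¹ • (S t.toNNReal x - x))) (𝓝[>] 0) (𝓝 (x, y)) :=
    (hS.tendsto_average x).prodMk_nhds h.tendsto_real
  refine hG.mem_of_tendsto hlim ?_
  filter_upwards [self_mem_nhdsWithin] with t ht
  exact (G.restrictScalars ℝ).smul_mem t⁻¹ (key t (le_of_lt ht) x)

end AbstractSemigroup

/-! ### Composition operators on `L²` -/

section Composition

variable {μ ν : Measure ℝ} {φ : ℝ → ℝ} {c : ℝ≥0}

lemma quasiMeasurePreserving_of_map_le (hφ : Measurable φ)
    (h : μ.map φ ≤ (c : ℝ≥0∞) • ν) : Measure.QuasiMeasurePreserving φ μ ν :=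
  ⟨hφ, Measure.absolutelyContinuous_of_le_smul h⟩

lemma memLp_comp_of_map_le (hφ : Measurable φ) (h : μ.map φ ≤ (c : ℝ≥0∞) • ν)
    {f : ℝ → ℂ} (hf : MemLp f 2 ν) : MemLp (f ∘ φ) 2 μ :=
  (hf.of_measure_le_smul ENNReal.coe_ne_top h).comp_of_map hφ.aemeasurable

lemma eLpNorm_comp_le_of_map_le (hφ : Measurable φ) (h : μ.map φ ≤ (c : ℝ≥0∞) • ν)
    {f : ℝ → ℂ} (hf : MemLp f 2 ν) :
    eLpNorm (f ∘ φ) 2 μ ≤ ENNReal.ofReal (Real.sqrt c) * eLpNorm f 2 ν := by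
  rw [← eLpNorm_map_measure (hf.of_measure_le_smul ENNReal.coe_ne_top h).1 hφ.aemeasurable]
  refine (eLpNorm_le_of_measure_le_smul h).trans (le_of_eq ?_)
  rw [smul_eq_mul]
  congr 1
  rw [Real.sqrt_eq_rpow, ← ENNReal.ofReal_rpow_of_nonneg c.coe_nonneg (by norm_num),
    ENNReal.ofReal_coe_nnreal]
  congr 1
  norm_num

/-- The bounded operator `f ↦ f ∘ φ` on `L²`, for `φ` whose image measure is at most a multiple
of the measure on the target. -/
def compLp (hφ : Measurable φ) (h : μ.map φ ≤ (c : ℝ≥0∞) • ν) :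
    Lp ℂ 2 ν →L[ℂ] Lp ℂ 2 μ :=
  LinearMap.mkContinuous
    { toFun := fun f => (memLp_comp_of_map_le hφ h (Lp.memLp f)).toLp (f ∘ φ)
      map_add' := fun f g => by
        refine Lp.ext ?_
        filter_upwards [MemLp.coeFn_toLp (memLp_comp_of_map_le hφ h (Lp.memLp (f + g))),
          MemLp.coeFn_toLp (memLp_comp_of_map_le hφ h (Lp.memLp f)),
          MemLp.coeFn_toLp (memLp_comp_of_map_le hφ h (Lp.memLp g)),
          Lp.coeFn_add ((memLp_comp_of_map_le hφ h (Lp.memLp f)).toLp (f ∘ φ))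
            ((memLp_comp_of_map_le hφ h (Lp.memLp g)).toLp (g ∘ φ)),
          (quasiMeasurePreserving_of_map_le hφ h).ae (Lp.coeFn_add f g)] with x h1 h2 h3 h4 h5
        rw [h1, h4, Pi.add_apply, h2, h3]
        exact h5
      map_smul' := fun a f => by
        refine Lp.ext ?_
        filter_upwards [MemLp.coeFn_toLp (memLp_comp_of_map_le hφ h (Lp.memLp (a • f))),
          MemLp.coeFn_toLp (memLp_comp_of_map_le hφ h (Lp.memLp f)),
          Lp.coeFn_smul a ((memLp_comp_of_map_le hφ h (Lp.memLp f)).toLp (f ∘ φ)),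
          (quasiMeasurePreserving_of_map_le hφ h).ae (Lp.coeFn_smul a f)] with x h1 h2 h4 h5
        rw [RingHom.id_apply, h1, h4, Pi.smul_apply, h2]
        exact h5 }
    (Real.sqrt c) fun f => by
      change ‖(memLp_comp_of_map_le hφ h (Lp.memLp f)).toLp (f ∘ φ)‖ ≤ _
      rw [Lp.norm_toLp, Lp.norm_def, ← ENNReal.toReal_ofReal (Real.sqrt_nonneg c),
        ← ENNReal.toReal_mul]
      exact ENNReal.toReal_mono (ENNReal.mul_ne_top ENNReal.ofReal_ne_top (Lp.eLpNorm_ne_top f))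
        (eLpNorm_comp_le_of_map_le hφ h (Lp.memLp f))

lemma coeFn_compLp (hφ : Measurable φ) (h : μ.map φ ≤ (c : ℝ≥0∞) • ν) (f : Lp ℂ 2 ν) :
    compLp hφ h f =ᵐ[μ] fun x => f (φ x) :=
  MemLp.coeFn_toLp (memLp_comp_of_map_le hφ h (Lp.memLp f))

lemma coeFn_compLp_of_ae_eq (hφ : Measurable φ) (h : μ.map φ ≤ (c : ℝ≥0∞) • ν)
    {f : Lp ℂ 2 ν} {g : ℝ → ℂ} (hg : f =ᵐ[ν] g) : compLp hφ h f =ᵐ[μ] fun x => g (φ x) :=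
  (coeFn_compLp hφ h f).trans ((quasiMeasurePreserving_of_map_le hφ h).ae hg)

lemma norm_compLp_le (hφ : Measurable φ) (h : μ.map φ ≤ (c : ℝ≥0∞) • ν) (f : Lp ℂ 2 ν) :
    ‖compLp hφ h f‖ ≤ Real.sqrt c * ‖f‖ :=
  ContinuousLinearMap.le_of_opNorm_le _
    (LinearMap.mkContinuous_norm_le _ (Real.sqrt_nonneg _) _) f

lemma norm_sq_eq_integral (f : Lp ℂ 2 μ) : ‖f‖ ^ 2 = ∫ x, ‖f x‖ ^ 2 ∂μ := by
  have h := L2.inner_def (𝕜 := ℂ) f f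
  rw [inner_self_eq_norm_sq_to_K] at h
  have h2 : ((‖f‖ ^ 2 : ℝ) : ℂ) = ((∫ x, ‖f x‖ ^ 2 ∂μ : ℝ) : ℂ) := by
    rw [← integral_complex_ofReal]
    simp only [inner_self_eq_norm_sq_to_K] at h
    push_cast
    exact_mod_cast h
  exact_mod_cast h2

end Composition

/-! ### Unfolding the energy space to the symmetric interval -/

/-- Half of Lebesgue measure on the interval `(-1,1)`. -/
abbrev symMeasure : Measure ℝ := (2⁻¹ : ℝ≥0∞) • volume.restrict (Ioo (-1 : ℝ) 1)

/-- The complex space `L²(-1,1)` for half of Lebesgue measure. -/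
abbrev SymL2 : Type := Lp ℂ 2 symMeasure

instance : IsFiniteMeasure symMeasure := by
  refine ⟨?_⟩
  simp only [symMeasure, Measure.smul_apply, smul_eq_mul]
  refine ENNReal.mul_lt_top (by simp) (measure_lt_top _ _)

lemma unitMeasure_le_symMeasure : unitMeasure ≤ ((2 : ℝ≥0) : ℝ≥0∞) • symMeasure := by
  rw [symMeasure, smul_smul, ENNReal.coe_ofNat, ENNReal.mul_inv_cancel (by simp) (by simp),
    one_smul]
  exact Measure.restrict_mono (Ioo_subset_Ioo_left (by norm_num)) le_rfl

lemma map_id_unitMeasure_le : unitMeasure.map id ≤ ((2 : ℝ≥0) : ℝ≥0∞) • symMeasure := by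
  rw [Measure.map_id]
  exact unitMeasure_le_symMeasure

lemma map_neg_unitMeasure_le :
    unitMeasure.map (fun x => -x) ≤ ((2 : ℝ≥0) : ℝ≥0∞) • symMeasure := by
  rw [symMeasure, smul_smul, ENNReal.coe_ofNat, ENNReal.mul_inv_cancel (by simp) (by simp),
    one_smul]
  refine Measure.le_iff.mpr fun A hA => ?_
  rw [Measure.map_apply measurable_neg hA, Measure.restrict_apply (measurable_neg hA),
    Measure.restrict_apply hA, ← Measure.measure_neg volume (A ∩ _)]
  refine measure_mono fun x hx => ?_
  simp only [mem_inter_iff, mem_preimage, mem_Ioo, Set.mem_neg] at hx ⊢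
  exact ⟨hx.1, by linarith [hx.2.2], by linarith [hx.2.1]⟩

/-- A subset of `(0,1)` has two mirror images under `|·|`, each of weight one half, which gives the
constant one; the origin is null. -/
lemma map_abs_symMeasure_le : symMeasure.map (fun x => |x|) ≤ ((1 : ℝ≥0) : ℝ≥0∞) • unitMeasure := by
  have hm : Measurable fun x : ℝ => |x| := measurable_norm
  rw [ENNReal.coe_one, one_smul]
  refine Measure.le_iff.mpr fun A hA => ?_
  rw [Measure.map_apply hm hA, symMeasure, Measure.smul_apply, Measure.restrict_apply (hm hA),
    Measure.restrict_apply hA]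
  have hsub : (fun x : ℝ => |x|) ⁻¹' A ∩ Ioo (-1) 1 ⊆
      (A ∩ Ioo 0 1) ∪ (-(A ∩ Ioo 0 1) ∪ {0}) := by
    rintro x ⟨hx, hx1, hx2⟩
    simp only [mem_preimage] at hx
    rcases lt_trichotomy x 0 with h | h | h
    · rw [abs_of_neg h] at hx
      exact Or.inr (Or.inl ⟨hx, by linarith, by linarith⟩)
    · exact Or.inr (Or.inr h)
    · rw [abs_of_pos h] at hx
      exact Or.inl ⟨hx, h, hx2⟩
  calc (2⁻¹ : ℝ≥0∞) • volume ((fun x : ℝ => |x|) ⁻¹' A ∩ Ioo (-1) 1)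
      ≤ 2⁻¹ * (volume (A ∩ Ioo 0 1) + (volume (A ∩ Ioo 0 1) + 0)) := by
        rw [smul_eq_mul]
        gcongr
        refine (measure_mono hsub).trans ((measure_union_le _ _).trans ?_)
        gcongr
        refine (measure_union_le _ _).trans ?_
        rw [Measure.measure_neg]
        simp
    _ = volume (A ∩ Ioo 0 1) := by
        rw [add_zero, ← two_mul, ← mul_assoc, ENNReal.inv_mul_cancel (by simp) (by simp), one_mul]

lemma ae_sym_of_ae_unit {p : ℝ → Prop} (h : ∀ᵐ x ∂unitMeasure, p x) :
    ∀ᵐ x ∂symMeasure, p |x| :=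
  (quasiMeasurePreserving_of_map_le measurable_norm map_abs_symMeasure_le).ae h

lemma ae_sym_mem : ∀ᵐ x ∂symMeasure, x ∈ Ioo (-1 : ℝ) 1 :=
  Measure.ae_smul_measure (ae_restrict_mem measurableSet_Ioo) _

/-- The function on the symmetric interval whose odd and even parts extend `f₁` and `f₂`. -/
def glue (f₁ f₂ : ℝ → ℂ) (x : ℝ) : ℂ := if 0 ≤ x then f₁ x + f₂ x else f₂ (-x) - f₁ (-x)

lemma glue_of_nonneg {f₁ f₂ : ℝ → ℂ} {x : ℝ} (hx : 0 ≤ x) : glue f₁ f₂ x = f₁ x + f₂ x :=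
  if_pos hx

lemma glue_of_neg {f₁ f₂ : ℝ → ℂ} {x : ℝ} (hx : x < 0) : glue f₁ f₂ x = f₂ (-x) - f₁ (-x) :=
  if_neg hx.not_ge

lemma memLp_glue {f₁ f₂ : ℝ → ℂ} (h₁ : MemLp f₁ 2 unitMeasure) (h₂ : MemLp f₂ 2 unitMeasure) :
    MemLp (glue f₁ f₂) 2 symMeasure := by
  have k₁ := memLp_comp_of_map_le measurable_norm map_abs_symMeasure_le h₁
  have k₂ := memLp_comp_of_map_le measurable_norm map_abs_symMeasure_le h₂
  have hs : Measurable fun x : ℝ => if 0 ≤ x then (1 : ℂ) else -1 :=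
    Measurable.ite measurableSet_Ici measurable_const measurable_const
  -- The glued function is `sign(x) f₁(|x|) + f₂(|x|)`, with the sign taken as `1` at the origin.
  have k₃ : MemLp (fun x : ℝ => (if 0 ≤ x then (1 : ℂ) else -1) * f₁ |x|) 2 symMeasure := by
    refine k₁.of_le (hs.aestronglyMeasurable.mul k₁.1) (Eventually.of_forall fun x => ?_)
    rw [norm_mul]
    split_ifs <;> simp
  refine (memLp_congr_ae (Eventually.of_forall fun x => ?_)).mpr (k₃.add k₂)
  rcases lt_or_ge x 0 with h | h
  · simp [glue_of_neg h, h.not_ge, abs_of_neg h]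
    ring
  · simp [glue_of_nonneg h, h, abs_of_nonneg h]

/-- The odd part of an element of `L²(-1,1)`, restricted to `(0,1)`. -/
def oddPart : SymL2 →L[ℂ] L2 :=
  (2⁻¹ : ℂ) • (compLp measurable_id map_id_unitMeasure_le -
    compLp measurable_neg map_neg_unitMeasure_le)

/-- The even part of an element of `L²(-1,1)`, restricted to `(0,1)`. -/
def evenPart : SymL2 →L[ℂ] L2 :=
  (2⁻¹ : ℂ) • (compLp measurable_id map_id_unitMeasure_le +
    compLp measurable_neg map_neg_unitMeasure_le)

lemma coeFn_oddPart {w : SymL2} {g : ℝ → ℂ} (hg : w =ᵐ[symMeasure] g) :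
    oddPart w =ᵐ[unitMeasure] fun x => (g x - g (-x)) / 2 := by
  filter_upwards [Lp.coeFn_smul (2⁻¹ : ℂ) (compLp measurable_id map_id_unitMeasure_le w -
      compLp measurable_neg map_neg_unitMeasure_le w),
    Lp.coeFn_sub (compLp measurable_id map_id_unitMeasure_le w)
      (compLp measurable_neg map_neg_unitMeasure_le w),
    coeFn_compLp_of_ae_eq measurable_id map_id_unitMeasure_le hg,
    coeFn_compLp_of_ae_eq measurable_neg map_neg_unitMeasure_le hg] with x h1 h2 h3 h4
  refine h1.trans ?_
  rw [Pi.smul_apply, h2, Pi.sub_apply, h3, h4, smul_eq_mul, id]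
  ring

lemma coeFn_evenPart {w : SymL2} {g : ℝ → ℂ} (hg : w =ᵐ[symMeasure] g) :
    evenPart w =ᵐ[unitMeasure] fun x => (g x + g (-x)) / 2 := by
  filter_upwards [Lp.coeFn_smul (2⁻¹ : ℂ) (compLp measurable_id map_id_unitMeasure_le w +
      compLp measurable_neg map_neg_unitMeasure_le w),
    Lp.coeFn_add (compLp measurable_id map_id_unitMeasure_le w)
      (compLp measurable_neg map_neg_unitMeasure_le w),
    coeFn_compLp_of_ae_eq measurable_id map_id_unitMeasure_le hg,
    coeFn_compLp_of_ae_eq measurable_neg map_neg_unitMeasure_le hg] with x h1 h2 h3 h4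
  refine h1.trans ?_
  rw [Pi.smul_apply, h2, Pi.add_apply, h3, h4, smul_eq_mul, id]
  ring

/-- The two restrictions see the right and left halves of the interval; the factor two undoes the
weight one half in `symMeasure`. -/
lemma norm_sq_restrict_add (w : SymL2) :
    ‖compLp measurable_id map_id_unitMeasure_le w‖ ^ 2 +
      ‖compLp measurable_neg map_neg_unitMeasure_le w‖ ^ 2 = 2 * ‖w‖ ^ 2 := by
  have hint : Integrable (fun x => ‖w x‖ ^ 2) (volume.restrict (Ioo (-1 : ℝ) 1)) := by
    have h1 : Integrable (fun x => ‖w x‖ ^ 2) symMeasure :=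
      (memLp_two_iff_integrable_sq_norm (Lp.memLp w).1).mp (Lp.memLp w)
    exact (integrable_smul_measure (by simp) (by simp)).mp h1
  have hi : IntervalIntegrable (fun x => ‖w x‖ ^ 2) volume (-1) 1 :=
    (intervalIntegrable_iff_integrableOn_Ioo_of_le (by norm_num)).mpr hint
  have e : ∀ (a b : ℝ) (_ : a ≤ b) (f : ℝ → ℝ), ∫ x in Ioo a b, f x = ∫ x in a..b, f x :=
    fun a b h f => by rw [intervalIntegral.integral_of_le h, integral_Ioc_eq_integral_Ioo]
  have e₁ : ∫ x, ‖compLp measurable_id map_id_unitMeasure_le w x‖ ^ 2 ∂unitMeasure =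
      ∫ x in (0 : ℝ)..1, ‖w x‖ ^ 2 := by
    rw [← e _ _ zero_le_one]
    refine integral_congr_ae ?_
    filter_upwards [coeFn_compLp measurable_id map_id_unitMeasure_le w] with x hx
    rw [hx, id]
  have e₂ : ∫ x, ‖compLp measurable_neg map_neg_unitMeasure_le w x‖ ^ 2 ∂unitMeasure =
      ∫ x in (-1 : ℝ)..0, ‖w x‖ ^ 2 := by
    rw [← neg_zero, ← intervalIntegral.integral_comp_neg, ← e _ _ zero_le_one]
    refine integral_congr_ae ?_
    filter_upwards [coeFn_compLp measurable_neg map_neg_unitMeasure_le w] with x hx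
    rw [hx]
  rw [norm_sq_eq_integral, norm_sq_eq_integral, norm_sq_eq_integral, e₁, e₂,
    integral_smul_measure, e _ _ (by norm_num), add_comm,
    intervalIntegral.integral_add_adjacent_intervals]
  · simp
  · exact hi.mono_set (by
      rw [uIcc_of_le (by norm_num), uIcc_of_le (by norm_num)]
      exact Icc_subset_Icc le_rfl (by norm_num))
  · exact hi.mono_set (by
      rw [uIcc_of_le (by norm_num), uIcc_of_le (by norm_num)]
      exact Icc_subset_Icc (by norm_num) le_rfl)

/-- The isometry `w ↦ (odd part of w, even part of w)`. -/
def foldIsometry : SymL2 →ₗᵢ[ℂ] Energy where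
  toFun w := WithLp.toLp 2 (oddPart w, evenPart w)
  map_add' v w := by
    rw [map_add, map_add]
    rfl
  map_smul' a w := by
    rw [map_smul, map_smul]
    rfl
  norm_map' w := by
    have h := norm_sq_restrict_add w
    -- Sum and difference of the two restrictions have total squared norm `4‖w‖²`, which the squared
    -- factor one quarter normalises.
    have hp := parallelogram_law_with_norm ℂ (compLp measurable_id map_id_unitMeasure_le w)
      (compLp measurable_neg map_neg_unitMeasure_le w)
    have h2 : ‖WithLp.toLp 2 (oddPart w, evenPart w)‖ ^ 2 = ‖w‖ ^ 2 := by
      rw [WithLp.prod_norm_sq_eq_of_L2]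
      change ‖(2⁻¹ : ℂ) • (compLp measurable_id map_id_unitMeasure_le w -
          compLp measurable_neg map_neg_unitMeasure_le w)‖ ^ 2 +
        ‖(2⁻¹ : ℂ) • (compLp measurable_id map_id_unitMeasure_le w +
          compLp measurable_neg map_neg_unitMeasure_le w)‖ ^ 2 = _
      simp only [norm_smul, mul_pow, norm_inv, RCLike.norm_ofNat]
      linarith
    exact (pow_left_inj₀ (norm_nonneg _) (norm_nonneg _) two_ne_zero).mp h2

/-- The element of `L²(-1,1)` whose odd and even parts are the components of `u`. -/
def unfold (u : Energy) : SymL2 := (memLp_glue (Lp.memLp u.fst) (Lp.memLp u.snd)).toLp _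

lemma coeFn_unfold (u : Energy) : unfold u =ᵐ[symMeasure] glue u.fst u.snd := MemLp.coeFn_toLp _

lemma coeFn_unfold_of_ae_eq {u : Energy} {f₁ f₂ : ℝ → ℂ} (h₁ : u.fst =ᵐ[unitMeasure] f₁)
    (h₂ : u.snd =ᵐ[unitMeasure] f₂) : unfold u =ᵐ[symMeasure] glue f₁ f₂ := by
  filter_upwards [coeFn_unfold u, ae_sym_of_ae_unit h₁, ae_sym_of_ae_unit h₂] with x h1 h2 h3
  rw [h1]
  rcases lt_or_ge x 0 with hx | hx
  · rw [abs_of_neg hx] at h2 h3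
    rw [glue_of_neg hx, glue_of_neg hx, h2, h3]
  · rw [abs_of_nonneg hx] at h2 h3
    rw [glue_of_nonneg hx, glue_of_nonneg hx, h2, h3]

lemma ae_unit_mem : ∀ᵐ x ∂unitMeasure, x ∈ Ioo (0 : ℝ) 1 := ae_restrict_mem measurableSet_Ioo

lemma foldIsometry_unfold (u : Energy) : foldIsometry (unfold u) = u := by
  refine WithLp.ofLp_injective 2 (Prod.ext (Lp.ext ?_) (Lp.ext ?_))
  · filter_upwards [coeFn_oddPart (coeFn_unfold u), ae_unit_mem] with x h hx
    refine h.trans ?_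
    rw [glue_of_nonneg hx.1.le, glue_of_neg (neg_lt_zero.mpr hx.1), neg_neg]
    change _ = u.fst x
    ring
  · filter_upwards [coeFn_evenPart (coeFn_unfold u), ae_unit_mem] with x h hx
    refine h.trans ?_
    rw [glue_of_nonneg hx.1.le, glue_of_neg (neg_lt_zero.mpr hx.1), neg_neg]
    change _ = u.snd x
    ring

/-- The unitary equivalence between `L²(-1,1)` and the energy space. -/
def foldEquiv : SymL2 ≃ₗᵢ[ℂ] Energy :=
  LinearIsometryEquiv.ofSurjective foldIsometry fun u => ⟨unfold u, foldIsometry_unfold u⟩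

lemma foldEquiv_symm_apply (u : Energy) : foldEquiv.symm u = unfold u :=
  foldEquiv.symm_apply_eq.mpr (foldIsometry_unfold u).symm

lemma coeFn_foldEquiv_fst {w : SymL2} {g : ℝ → ℂ} (hg : w =ᵐ[symMeasure] g) :
    (foldEquiv w).fst =ᵐ[unitMeasure] fun x => (g x - g (-x)) / 2 := coeFn_oddPart hg

lemma coeFn_foldEquiv_snd {w : SymL2} {g : ℝ → ℂ} (hg : w =ᵐ[symMeasure] g) :
    (foldEquiv w).snd =ᵐ[unitMeasure] fun x => (g x + g (-x)) / 2 := coeFn_evenPart hg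

/-! ### The free semigroup -/

/-- The flow of the vector field `1 - x`. -/
def flow (t x : ℝ) : ℝ := 1 - (1 - x) * Real.exp (-t)

lemma flow_zero (x : ℝ) : flow 0 x = x := by simp [flow]

lemma flow_add (s t x : ℝ) : flow (s + t) x = flow t (flow s x) := by
  simp only [flow, neg_add, Real.exp_add]
  ring

lemma one_sub_flow (t x : ℝ) : 1 - flow t x = (1 - x) * Real.exp (-t) := by
  simp [flow]

/-- The point `1` is fixed and `-1` is an inflow point of the vector field `1 - x`, so forward
characteristics never leave the interval. -/
lemma flow_mem_Ioo {t x : ℝ} (ht : 0 ≤ t) (hx : x ∈ Ioo (-1 : ℝ) 1) :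
    flow t x ∈ Ioo (-1 : ℝ) 1 := by
  have h1 : Real.exp (-t) ≤ 1 := Real.exp_le_one_iff.mpr (by linarith)
  have h2 := Real.exp_pos (-t)
  constructor <;> simp only [flow] <;> nlinarith [hx.1, hx.2]

lemma flow_mem_Icc {t x : ℝ} (ht : 0 ≤ t) (hx : x ∈ Icc (-1 : ℝ) 1) :
    flow t x ∈ Icc (-1 : ℝ) 1 := by
  have h1 : Real.exp (-t) ≤ 1 := Real.exp_le_one_iff.mpr (by linarith)
  have h2 := Real.exp_pos (-t)
  constructor <;> simp only [flow] <;> nlinarith [hx.1, hx.2]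

lemma flow_eq (t x : ℝ) : flow t x = Real.exp (-t) * x + (1 - Real.exp (-t)) := by
  simp only [flow]
  ring

lemma continuous_flow (t : ℝ) : Continuous (flow t) := by
  unfold flow
  fun_prop

/-- The flow is affine with slope `e^{-t}`, so preimages are stretched by `e^t`; forward invariance
prevents any loss outside the interval. The square root of this constant is the growth bound. -/
lemma map_flow_symMeasure_le (t : ℝ≥0) :
    symMeasure.map (flow t) ≤ ((Real.toNNReal (Real.exp t) : ℝ≥0) : ℝ≥0∞) • symMeasure := by
  have hm := (continuous_flow t).measurable
  refine Measure.le_iff.mpr fun A hA => ?_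
  rw [Measure.map_apply hm hA]
  simp only [symMeasure, Measure.smul_apply, smul_eq_mul]
  rw [Measure.restrict_apply (hm hA), Measure.restrict_apply hA, mul_left_comm]
  gcongr
  have hvol : volume (flow t ⁻¹' (A ∩ Ioo (-1) 1)) =
      ENNReal.ofReal (Real.exp t) * volume (A ∩ Ioo (-1) 1) := by
    have : flow t ⁻¹' (A ∩ Ioo (-1) 1) = (fun x => Real.exp (-t) * x) ⁻¹'
        ((fun x => x + (1 - Real.exp (-t))) ⁻¹' (A ∩ Ioo (-1) 1)) := by
      ext x
      simp only [mem_preimage, flow_eq]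
    rw [this, Real.volume_preimage_mul_left (Real.exp_pos _).ne', measure_preimage_add_right,
      ← Real.exp_neg, neg_neg, abs_of_pos (Real.exp_pos _)]
  rw [← ENNReal.ofReal, ← hvol]
  exact measure_mono fun x hx => ⟨hx.1, flow_mem_Ioo t.2 hx.2⟩

/-- Composition with the flow as an operator on `L²(-1,1)`. -/
def flowOperator (t : ℝ≥0) : SymL2 →L[ℂ] SymL2 :=
  compLp (continuous_flow t).measurable (map_flow_symMeasure_le t)

lemma coeFn_flowOperator (t : ℝ≥0) {w : SymL2} {g : ℝ → ℂ} (hg : w =ᵐ[symMeasure] g) :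
    flowOperator t w =ᵐ[symMeasure] fun x => g (flow t x) := coeFn_compLp_of_ae_eq _ _ hg

lemma norm_flowOperator_le (t : ℝ≥0) (w : SymL2) :
    ‖flowOperator t w‖ ≤ Real.exp ((t : ℝ) / 2) * ‖w‖ := by
  refine (norm_compLp_le _ _ w).trans (le_of_eq ?_)
  rw [Real.coe_toNNReal _ (Real.exp_pos _).le, Real.exp_half]

/-- The semigroup generated by the closure of the free operator. -/
def freeSemigroup (t : ℝ≥0) : Energy →L[ℂ] Energy :=
  (foldEquiv.toContinuousLinearEquiv : SymL2 →L[ℂ] Energy).comp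
    ((flowOperator t).comp (foldEquiv.symm.toContinuousLinearEquiv : Energy →L[ℂ] SymL2))

lemma freeSemigroup_apply (t : ℝ≥0) (u : Energy) :
    freeSemigroup t u = foldEquiv (flowOperator t (foldEquiv.symm u)) := rfl

lemma freeSemigroup_foldEquiv (t : ℝ≥0) (w : SymL2) :
    freeSemigroup t (foldEquiv w) = foldEquiv (flowOperator t w) := by
  rw [freeSemigroup_apply, LinearIsometryEquiv.symm_apply_apply]

lemma norm_freeSemigroup_le (t : ℝ≥0) (u : Energy) :
    ‖freeSemigroup t u‖ ≤ Real.exp ((t : ℝ) / 2) * ‖u‖ := by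
  rw [freeSemigroup_apply, LinearIsometryEquiv.norm_map]
  refine (norm_flowOperator_le t _).trans (le_of_eq ?_)
  rw [LinearIsometryEquiv.norm_map]

lemma flowOperator_zero (w : SymL2) : flowOperator 0 w = w := by
  refine Lp.ext ?_
  filter_upwards [coeFn_flowOperator 0 (ae_eq_refl w)] with x hx
  rw [hx, NNReal.coe_zero, flow_zero]

lemma flowOperator_add (s t : ℝ≥0) (w : SymL2) :
    flowOperator (s + t) w = flowOperator s (flowOperator t w) := by
  refine Lp.ext ?_
  filter_upwards [coeFn_flowOperator (s + t) (ae_eq_refl w),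
    coeFn_flowOperator s (coeFn_flowOperator t (ae_eq_refl w))] with x h1 h2
  rw [h1, h2, NNReal.coe_add, flow_add]

/-! ### Strong continuity -/

/-- Bounded convergence in `L²` of a finite measure. -/
lemma tendsto_Lp_of_bounded {μ : Measure ℝ} [IsFiniteMeasure μ] {ι : Type*} {l : Filter ι}
    [l.IsCountablyGenerated] [l.NeBot] {W : ι → Lp ℂ 2 μ} {w : Lp ℂ 2 μ} {F : ι → ℝ → ℂ}
    {f : ℝ → ℂ} (hW : ∀ i, W i =ᵐ[μ] F i) (hw : w =ᵐ[μ] f) {C : ℝ}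
    (hC : ∀ᵐ x ∂μ, ∀ i, ‖F i x‖ ≤ C)
    (hlim : ∀ᵐ x ∂μ, Tendsto (fun i => F i x) l (𝓝 (f x))) : Tendsto W l (𝓝 w) := by
  rw [tendsto_iff_norm_sub_tendsto_zero]
  have hsq : Tendsto (fun i => ‖W i - w‖ ^ 2) l (𝓝 0) := by
    simp only [norm_sq_eq_integral]
    have h0 : (0 : ℝ) = ∫ _, (0 : ℝ) ∂μ := by simp
    rw [h0]
    have hsub : ∀ i, ((W i - w : Lp ℂ 2 μ) : ℝ → ℂ) =ᵐ[μ] fun x => F i x - f x := fun i => by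
      filter_upwards [Lp.coeFn_sub (W i) w, hW i, hw] with x h1 h2 h3
      rw [h1, Pi.sub_apply, h2, h3]
    have hb : ∀ᵐ x ∂μ, ‖f x‖ ≤ C := by
      filter_upwards [hC, hlim] with x h1 h2
      exact le_of_tendsto h2.norm (Eventually.of_forall h1)
    have key : Tendsto (fun i => ∫ x, ‖F i x - f x‖ ^ 2 ∂μ) l (𝓝 (∫ _, (0 : ℝ) ∂μ)) := by
      refine tendsto_integral_filter_of_dominated_convergence (fun _ => (C + C) ^ 2)
        (Eventually.of_forall fun i => ?_) (Eventually.of_forall fun i => ?_)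
        (integrable_const _) ?_
      · exact (((Lp.memLp (W i - w)).1.congr (hsub i)).norm.pow 2)
      · filter_upwards [hC, hb] with x h1 h2
        rw [Real.norm_of_nonneg (by positivity)]
        have := (norm_sub_le (F i x) (f x)).trans (add_le_add (h1 i) h2)
        gcongr
      · filter_upwards [hlim] with x hx
        have := ((tendsto_iff_norm_sub_tendsto_zero.mp hx).pow 2)
        simpa using this
    refine key.congr fun i => integral_congr_ae ?_
    filter_upwards [hsub i] with x hx
    rw [hx]
  have := hsq.sqrt
  simpa using this

lemma continuous_flow_left (x : ℝ) : Continuous fun t : ℝ => flow t x := by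
  unfold flow
  fun_prop

lemma continuous_flowOperator_of_bounded {w : SymL2} {g : ℝ → ℂ} (hg : w =ᵐ[symMeasure] g)
    (hc : Continuous g) {C : ℝ} (hC : ∀ x, ‖g x‖ ≤ C) :
    Continuous fun t : ℝ≥0 => flowOperator t w := by
  refine continuous_iff_continuousAt.mpr fun t => ?_
  refine tendsto_Lp_of_bounded (F := fun (s : ℝ≥0) x => g (flow s x)) (C := C)
    (fun s => coeFn_flowOperator s hg) (coeFn_flowOperator t hg)
    (Eventually.of_forall fun x s => hC _) (Eventually.of_forall fun x => ?_)
  exact (hc.comp ((continuous_flow_left x).comp NNReal.continuous_coe)).tendsto t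

lemma continuous_flowOperator (w : SymL2) : Continuous fun t : ℝ≥0 => flowOperator t w := by
  refine continuous_iff_continuousAt.mpr fun t => Metric.tendsto_nhds.mpr fun ε hε => ?_
  -- `K` dominates the operator norm at all times below `t + 1`, so one smooth approximation of `w`
  -- serves for all of them.
  set K : ℝ := Real.exp (((t : ℝ) + 1) / 2) with hK
  have hK0 : 0 < K := Real.exp_pos _
  obtain ⟨v, ⟨g, hvg, hgs, hgc⟩, hv⟩ :=
    (MeasureTheory.Lp.dense_hasCompactSupport_contDiff (F := ℂ) (μ := symMeasure)
      (p := 2) (by simp)).exists_dist_lt w (ε := ε / (3 * K)) (by positivity)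
  obtain ⟨C, hC⟩ := hgs.exists_bound_of_continuous hgc.continuous
  have hcont := (continuous_flowOperator_of_bounded hvg hgc.continuous hC).tendsto t
  have hbound : ∀ s : ℝ≥0, s < t + 1 → dist (flowOperator s w) (flowOperator s v) < ε / 3 := by
    intro s hs
    have hs' : (s : ℝ) < t + 1 := by exact_mod_cast hs
    rw [dist_eq_norm, ← map_sub]
    refine (norm_flowOperator_le s _).trans_lt ?_
    rw [dist_eq_norm] at hv
    calc Real.exp ((s : ℝ) / 2) * ‖w - v‖ ≤ K * ‖w - v‖ := by
          gcongr
          rw [hK]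
          gcongr
      _ < K * (ε / (3 * K)) := by gcongr
      _ = ε / 3 := by field_simp
  filter_upwards [Metric.tendsto_nhds.mp hcont (ε / 3) (by positivity),
    Iio_mem_nhds (lt_add_one t)] with s h1 h2
  have h3 := hbound s h2
  have h4 := hbound t (lt_add_one t)
  rw [dist_comm] at h4
  calc dist (flowOperator s w) (flowOperator t w)
      ≤ dist (flowOperator s w) (flowOperator s v) + dist (flowOperator s v) (flowOperator t v)
        + dist (flowOperator t v) (flowOperator t w) := dist_triangle4 _ _ _ _
    _ < ε := by linarith

lemma isC0Semigroup_freeSemigroup : IsC0Semigroup freeSemigroup where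
  map_zero := by
    ext1 u
    rw [freeSemigroup_apply, flowOperator_zero, LinearIsometryEquiv.apply_symm_apply]
    rfl
  map_add s t := by
    ext1 u
    rw [ContinuousLinearMap.comp_apply, freeSemigroup_apply t, freeSemigroup_foldEquiv,
      ← flowOperator_add, freeSemigroup_apply]
  strongly_continuous u := foldEquiv.continuous.comp (continuous_flowOperator _)

lemma norm_freeSemigroup_le' (t : ℝ≥0) (u : Energy) :
    ‖freeSemigroup t u‖ ≤ Real.exp ((1 / 2 : ℝ) * t) * ‖u‖ := by
  rw [one_div, inv_mul_eq_div]
  exact norm_freeSemigroup_le t u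

/-! ### The generator of the free semigroup -/

/-- The jump of the glued function at zero is `2 f₁(0)`, so this is where the boundary condition
enters. A kink of the even part remains possible, hence Lipschitz rather than `C¹`. -/
lemma exists_lipschitz_glue {f₁ f₂ : ℝ → ℂ} (h₁ : ContDiffOn ℝ 1 f₁ (Icc 0 1))
    (h₂ : ContDiffOn ℝ 1 f₂ (Icc 0 1)) (h0 : f₁ 0 = 0) :
    ∃ K : ℝ, 0 ≤ K ∧ ∀ x ∈ Icc (-1 : ℝ) 1, ∀ y ∈ Icc (-1 : ℝ) 1,
      ‖glue f₁ f₂ x - glue f₁ f₂ y‖ ≤ K * |x - y| := by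
  obtain ⟨K₁, hK₁⟩ := h₁.exists_lipschitzOnWith one_ne_zero (convex_Icc 0 1) isCompact_Icc
  obtain ⟨K₂, hK₂⟩ := h₂.exists_lipschitzOnWith one_ne_zero (convex_Icc 0 1) isCompact_Icc
  have l₁ : ∀ x ∈ Icc (0 : ℝ) 1, ∀ y ∈ Icc (0 : ℝ) 1, ‖f₁ x - f₁ y‖ ≤ K₁ * |x - y| :=
    fun x hx y hy => by simpa [Real.norm_eq_abs] using hK₁.norm_sub_le hx hy
  have l₂ : ∀ x ∈ Icc (0 : ℝ) 1, ∀ y ∈ Icc (0 : ℝ) 1, ‖f₂ x - f₂ y‖ ≤ K₂ * |x - y| :=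
    fun x hx y hy => by simpa [Real.norm_eq_abs] using hK₂.norm_sub_le hx hy
  have z : (0 : ℝ) ∈ Icc (0 : ℝ) 1 := ⟨le_rfl, zero_le_one⟩
  -- For points on opposite sides, `f₁` is compared with its zero value at the origin, and the two
  -- distances to the origin add up to `|x - y|`. For `f₂`, reflection only shortens the distance.
  have mixed : ∀ x ∈ Icc (0 : ℝ) 1, ∀ y ∈ Ico (-1 : ℝ) 0,
      ‖glue f₁ f₂ x - glue f₁ f₂ y‖ ≤ (K₁ + K₂ : ℝ) * |x - y| := by
    intro x hx y hy
    have hy' : -y ∈ Icc (0 : ℝ) 1 := ⟨by linarith [hy.2], by linarith [hy.1]⟩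
    rw [glue_of_nonneg hx.1, glue_of_neg hy.2]
    have a₁ := l₁ x hx 0 z
    have a₂ := l₁ (-y) hy' 0 z
    have a₃ := l₂ x hx (-y) hy'
    rw [h0, sub_zero, sub_zero, abs_of_nonneg hx.1] at a₁
    rw [h0, sub_zero, sub_zero, abs_of_nonneg hy'.1] at a₂
    have e : |x - -y| ≤ x - y := abs_le.mpr ⟨by linarith [hx.1], by linarith [hy.2]⟩
    have e' : |x - y| = x - y := abs_of_nonneg (by linarith [hx.1, hy.2])
    rw [e']
    calc ‖f₁ x + f₂ x - (f₂ (-y) - f₁ (-y))‖ = ‖f₁ x + f₁ (-y) + (f₂ x - f₂ (-y))‖ := by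
          congr 1; ring
      _ ≤ ‖f₁ x‖ + ‖f₁ (-y)‖ + ‖f₂ x - f₂ (-y)‖ := norm_add₃_le
      _ ≤ K₁ * x + K₁ * (-y) + K₂ * (x - y) := by
          gcongr
          exact a₃.trans (by gcongr)
      _ = (K₁ + K₂) * (x - y) := by ring
  refine ⟨K₁ + K₂, by positivity, fun x hx y hy => ?_⟩
  rcases lt_or_ge x 0 with hx0 | hx0 <;> rcases lt_or_ge y 0 with hy0 | hy0
  · rw [glue_of_neg hx0, glue_of_neg hy0]
    have hx' : -x ∈ Icc (0 : ℝ) 1 := ⟨by linarith, by linarith [hx.1]⟩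
    have hy' : -y ∈ Icc (0 : ℝ) 1 := ⟨by linarith, by linarith [hy.1]⟩
    have e : |-x - -y| = |x - y| := by rw [← abs_neg]; congr 1; ring
    have a₁ := l₁ _ hx' _ hy'
    have a₂ := l₂ _ hx' _ hy'
    rw [e] at a₁ a₂
    calc ‖f₂ (-x) - f₁ (-x) - (f₂ (-y) - f₁ (-y))‖
        = ‖(f₂ (-x) - f₂ (-y)) - (f₁ (-x) - f₁ (-y))‖ := by congr 1; ring
      _ ≤ ‖f₂ (-x) - f₂ (-y)‖ + ‖f₁ (-x) - f₁ (-y)‖ := norm_sub_le _ _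
      _ ≤ (K₁ + K₂) * |x - y| := by linarith
  · rw [norm_sub_rev, abs_sub_comm]
    exact mixed y ⟨hy0, hy.2⟩ x ⟨hx.1, hx0⟩
  · exact mixed x ⟨hx0, hx.2⟩ y ⟨hy.1, hy0⟩
  · rw [glue_of_nonneg hx0, glue_of_nonneg hy0]
    have a₁ := l₁ x ⟨hx0, hx.2⟩ y ⟨hy0, hy.2⟩
    have a₂ := l₂ x ⟨hx0, hx.2⟩ y ⟨hy0, hy.2⟩
    calc ‖f₁ x + f₂ x - (f₁ y + f₂ y)‖ = ‖(f₁ x - f₁ y) + (f₂ x - f₂ y)‖ := by congr 1; ring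
      _ ≤ ‖f₁ x - f₁ y‖ + ‖f₂ x - f₂ y‖ := norm_add_le _ _
      _ ≤ (K₁ + K₂) * |x - y| := by linarith

/-- The displacement is `(1 - x)(1 - e^{-t})`, with `1 - x ≤ 2` and `1 - e^{-t} ≤ t`. -/
lemma abs_flow_sub_le {t x : ℝ} (ht : 0 ≤ t) (hx : x ∈ Ioo (-1 : ℝ) 1) :
    |flow t x - x| ≤ 2 * t := by
  have h1 : Real.exp (-t) ≤ 1 := Real.exp_le_one_iff.mpr (by linarith)
  have h2 := Real.add_one_le_exp (-t)
  have e : flow t x - x = (1 - x) * (1 - Real.exp (-t)) := by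
    simp only [flow]
    ring
  rw [e, abs_of_nonneg (mul_nonneg (by linarith [hx.2]) (by linarith))]
  exact mul_le_mul (by linarith [hx.1]) (by linarith) (by linarith) (by norm_num)

lemma hasDerivAt_flow (x : ℝ) : HasDerivAt (fun t => flow t x) (1 - x) 0 := by
  have h := (((hasDerivAt_id (0 : ℝ)).neg.exp).const_mul (1 - x)).const_sub 1
  simpa [flow] using h

lemma hasDerivAt_glue_of_pos {f₁ f₂ : ℝ → ℂ} (h₁ : ContDiffOn ℝ 1 f₁ (Icc 0 1))
    (h₂ : ContDiffOn ℝ 1 f₂ (Icc 0 1)) {x : ℝ} (hx : x ∈ Ioo (0 : ℝ) 1) :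
    HasDerivAt (glue f₁ f₂) (deriv f₁ x + deriv f₂ x) x := by
  have h := (differentiableAt_of_contDiffOn h₁ hx).hasDerivAt.add
    (differentiableAt_of_contDiffOn h₂ hx).hasDerivAt
  refine h.congr_of_eventuallyEq ?_
  filter_upwards [Ioi_mem_nhds hx.1] with y hy
  exact glue_of_nonneg (le_of_lt hy)

lemma hasDerivAt_glue_of_neg {f₁ f₂ : ℝ → ℂ} (h₁ : ContDiffOn ℝ 1 f₁ (Icc 0 1))
    (h₂ : ContDiffOn ℝ 1 f₂ (Icc 0 1)) {x : ℝ} (hx : -x ∈ Ioo (0 : ℝ) 1) :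
    HasDerivAt (glue f₁ f₂) (deriv f₁ (-x) - deriv f₂ (-x)) x := by
  have k₁ := (differentiableAt_of_contDiffOn h₁ hx).hasDerivAt.scomp x (hasDerivAt_neg x)
  have k₂ := (differentiableAt_of_contDiffOn h₂ hx).hasDerivAt.scomp x (hasDerivAt_neg x)
  have h := k₂.sub k₁
  have e : (-1 : ℝ) • deriv f₂ (-x) - (-1 : ℝ) • deriv f₁ (-x) =
      deriv f₁ (-x) - deriv f₂ (-x) := by
    simp only [neg_smul, one_smul]
    ring
  rw [e] at h
  refine h.congr_of_eventuallyEq ?_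
  filter_upwards [Iio_mem_nhds (neg_pos.mp hx.1)] with y hy
  exact glue_of_neg hy

lemma tendsto_flow_quotient {g : ℝ → ℂ} {g' : ℂ} {x : ℝ} (hg : HasDerivAt g g' x) :
    Tendsto (fun h : ℝ≥0 => ((h : ℝ) : ℂ)⁻¹ * (g (flow h x) - g x)) (𝓝[>] 0)
      (𝓝 ((1 - x : ℝ) * g')) := by
  have hg' : HasDerivAt g g' (flow 0 x) := by rwa [flow_zero]
  have h1 := hg'.scomp (0 : ℝ) (hasDerivAt_flow x)
  have h2 := (hasDerivWithinAt_iff_tendsto_slope' self_notMem_Ioi).mp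
    (h1.hasDerivWithinAt (s := Ioi 0))
  refine ((h2.comp tendsto_coe_nhdsGT_zero).congr fun t => ?_).trans (le_of_eq ?_)
  · simp only [Function.comp, slope, vsub_eq_sub, sub_zero, flow_zero, Complex.real_smul,
      Complex.ofReal_inv]
  · rw [Complex.real_smul]

/-- Here the system becomes scalar transport: `v₁ + v₂ = (1 - ρ)(f₁' + f₂')` on the right half, and
`v₂ - v₁ = (1 + ρ)(f₁' - f₂')` with `ρ = -x` on the left half. The possible kink at the origin is a
null set. -/
lemma FreeRel.ae_tendsto {f₁ f₂ : ℝ → ℂ} {u v : Energy} (h : FreeRel f₁ f₂ u v) :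
    ∀ᵐ x ∂symMeasure, Tendsto (fun t : ℝ≥0 => ((t : ℝ) : ℂ)⁻¹ *
      (glue f₁ f₂ (flow t x) - glue f₁ f₂ x)) (𝓝[>] 0) (𝓝 (glue v.fst v.snd x)) := by
  filter_upwards [ae_sym_of_ae_unit h.val_fst, ae_sym_of_ae_unit h.val_snd,
    ae_sym_of_ae_unit ae_unit_mem] with x h1 h2 hx
  rcases lt_trichotomy x 0 with hx0 | rfl | hx0
  · rw [abs_of_neg hx0] at h1 h2 hx
    have := tendsto_flow_quotient (hasDerivAt_glue_of_neg h.smooth_fst h.smooth_snd hx)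
    convert this using 2
    rw [glue_of_neg hx0, h1, h2]
    push_cast
    ring
  · simp at hx
  · rw [abs_of_pos hx0] at h1 h2 hx
    have := tendsto_flow_quotient (hasDerivAt_glue_of_pos h.smooth_fst h.smooth_snd hx)
    convert this using 2
    rw [glue_of_nonneg hx0.le, h1, h2]
    push_cast
    ring

lemma FreeRel.coeFn_unfold {f₁ f₂ : ℝ → ℂ} {u v : Energy} (h : FreeRel f₁ f₂ u v) :
    unfold u =ᵐ[symMeasure] glue f₁ f₂ := coeFn_unfold_of_ae_eq h.arg_fst h.arg_snd

lemma hasGenerator_of_mem_freeGraph {p : Energy × Energy} (hp : p ∈ freeGraph) :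
    HasGenerator freeSemigroup p.1 p.2 := by
  obtain ⟨u, v⟩ := p
  obtain ⟨f₁, f₂, h⟩ := hp
  change FreeRel f₁ f₂ u v at h
  change HasGenerator freeSemigroup u v
  obtain ⟨K, hK0, hK⟩ := exists_lipschitz_glue h.smooth_fst h.smooth_snd h.boundary
  have hne : (𝓝[>] (0 : ℝ≥0)).NeBot := tendsto_toNNReal_nhdsGT_zero.neBot
  have key : Tendsto (fun t : ℝ≥0 => ((t : ℝ) : ℂ)⁻¹ • (flowOperator t (unfold u) - unfold u))
      (𝓝[>] 0) (𝓝 (unfold v)) := by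
    refine tendsto_Lp_of_bounded (C := K * 2) (fun t => ?_) (coeFn_unfold v) ?_ h.ae_tendsto
    · filter_upwards [Lp.coeFn_smul (((t : ℝ) : ℂ)⁻¹) (flowOperator t (unfold u) - unfold u),
        Lp.coeFn_sub (flowOperator t (unfold u)) (unfold u), h.coeFn_unfold,
        coeFn_flowOperator t h.coeFn_unfold] with x h1 h2 h3 h4
      rw [h1, Pi.smul_apply, h2, Pi.sub_apply, h3, h4, smul_eq_mul]
    · filter_upwards [ae_sym_mem] with x hx t
      -- The dominating constant is needed for every `t`; at `t = 0` the quotient is zero because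
      -- `0⁻¹ = 0`.
      rcases eq_or_ne t 0 with rfl | ht
      · simp [hK0]
      have ht' : (0 : ℝ) < t := NNReal.coe_pos.mpr (pos_iff_ne_zero.mpr ht)
      rw [norm_mul, norm_inv, Complex.norm_real, Real.norm_of_nonneg t.coe_nonneg,
        inv_mul_le_iff₀ ht']
      refine (hK _ (flow_mem_Icc t.2 (Ioo_subset_Icc_self hx)) _
        (Ioo_subset_Icc_self hx)).trans ?_
      calc K * |flow t x - x| ≤ K * (2 * t) := by
            gcongr
            exact abs_flow_sub_le t.2 hx
        _ = t * (K * 2) := by ring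
  have h2 := (foldEquiv.continuous.tendsto _).comp key
  have e : foldEquiv (unfold v) = v := foldIsometry_unfold v
  rw [e] at h2
  refine h2.congr fun t => ?_
  simp only [Function.comp]
  rw [map_smul, map_sub, freeSemigroup_apply, foldEquiv_symm_apply]
  congr 2
  exact foldIsometry_unfold u

/-! ### A smooth core and the identification of the generator. -/

/-- For a `C¹` function on the whole line the boundary condition is automatic, since the first
component is an odd part. -/
lemma mem_freeGraph_of_contDiff {w w' : SymL2} {g : ℝ → ℂ} (hg : ContDiff ℝ 1 g)
    (hw : w =ᵐ[symMeasure] g)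
    (hw' : w' =ᵐ[symMeasure] fun x => ((1 - x : ℝ) : ℂ) * deriv g x) :
    (foldEquiv w, foldEquiv w') ∈ freeGraph := by
  have hneg : ContDiff ℝ 1 fun x => g (-x) := hg.comp contDiff_neg
  have hd : ∀ x, HasDerivAt g (deriv g x) x := fun x =>
    (hg.differentiable one_ne_zero x).hasDerivAt
  have hdn : ∀ x, HasDerivAt (fun x => g (-x)) (-deriv g (-x)) x := fun x => by
    have := (hd (-x)).scomp x (hasDerivAt_neg x)
    simpa using! this
  have d₁ : ∀ x, deriv (fun x => (g x - g (-x)) / 2) x = (deriv g x + deriv g (-x)) / 2 :=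
    fun x => by
      refine (((hd x).sub (hdn x)).div_const 2).deriv.trans ?_
      ring
  have d₂ : ∀ x, deriv (fun x => (g x + g (-x)) / 2) x = (deriv g x - deriv g (-x)) / 2 :=
    fun x => by
      refine (((hd x).add (hdn x)).div_const 2).deriv.trans ?_
      ring
  refine ⟨fun x => (g x - g (-x)) / 2, fun x => (g x + g (-x)) / 2, ?_, ?_, ?_,
    coeFn_foldEquiv_fst hw, coeFn_foldEquiv_snd hw, ?_, ?_⟩
  · exact ((hg.sub hneg).div_const 2).contDiffOn
  · exact ((hg.add hneg).div_const 2).contDiffOn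
  · simp
  · filter_upwards [coeFn_foldEquiv_fst hw'] with x hx
    refine hx.trans ?_
    rw [d₁, d₂]
    push_cast
    ring
  · filter_upwards [coeFn_foldEquiv_snd hw'] with x hx
    refine hx.trans ?_
    rw [d₁, d₂]
    push_cast
    ring

lemma deriv_comp_flow {g : ℝ → ℂ} (hg : ContDiff ℝ 1 g) (t x : ℝ) :
    deriv (fun x => g (flow t x)) x = Real.exp (-t) * deriv g (flow t x) := by
  have h1 : HasDerivAt (flow t) (Real.exp (-t)) x := by
    have := (((hasDerivAt_id x).const_mul (Real.exp (-t))).add_const (1 - Real.exp (-t)))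
    rw [mul_one] at this
    refine this.congr_of_eventuallyEq (Eventually.of_forall fun y => ?_)
    exact flow_eq t y
  have h2 := ((hg.differentiable one_ne_zero (flow t x)).hasDerivAt).scomp x h1
  rw [Complex.real_smul] at h2
  exact h2.deriv

lemma contDiff_flow (t : ℝ) : ContDiff ℝ 1 (flow t) := by
  unfold flow
  fun_prop

/-- A dense set of smooth states whose orbits stay in the domain of the free operator. -/
lemma exists_dense_core : ∃ D : Set Energy, Dense D ∧ ∀ u ∈ D, ∃ v,
    HasGenerator freeSemigroup u v ∧
      ∀ t, (freeSemigroup t u, freeSemigroup t v) ∈ freeGraph.topologicalClosure := by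
  refine ⟨foldEquiv '' {w : SymL2 | ∃ g : ℝ → ℂ, w =ᵐ[symMeasure] g ∧ HasCompactSupport g ∧
    ContDiff ℝ ∞ g}, ?_, ?_⟩
  · exact foldEquiv.surjective.denseRange.dense_image foldEquiv.continuous
      (MeasureTheory.Lp.dense_hasCompactSupport_contDiff (by simp))
  · rintro _ ⟨w, ⟨g, hwg, hgs, hgc⟩, rfl⟩
    have hg1 : ContDiff ℝ 1 g := hgc.of_le (by exact_mod_cast le_top)
    have hmem : MemLp (fun x => ((1 - x : ℝ) : ℂ) * deriv g x) 2 symMeasure := by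
      refine Continuous.memLp_of_hasCompactSupport ?_ ?_
      · exact (by fun_prop : Continuous fun x : ℝ => ((1 - x : ℝ) : ℂ)).mul
          (hg1.continuous_deriv le_rfl)
      · exact hgs.deriv.mul_left
    -- Composition with the flow preserves `C¹`, and `1 - flow t x = (1 - x)e^{-t}` shows that it
    -- commutes with `(1 - x) d/dx`.
    have hgraph : ∀ t : ℝ≥0, (foldEquiv (flowOperator t w),
        foldEquiv (flowOperator t (hmem.toLp _))) ∈ freeGraph := by
      intro t
      refine mem_freeGraph_of_contDiff (hg1.comp (contDiff_flow t))
        (coeFn_flowOperator t hwg) ?_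
      filter_upwards [coeFn_flowOperator t hmem.coeFn_toLp] with x hx
      rw [hx, one_sub_flow]
      change _ = _ * deriv (fun x => g (flow t x)) x
      rw [deriv_comp_flow hg1]
      push_cast
      ring
    refine ⟨foldEquiv (hmem.toLp _), ?_, fun t => ?_⟩
    · have := hasGenerator_of_mem_freeGraph (hgraph 0)
      rwa [flowOperator_zero, flowOperator_zero] at this
    · rw [freeSemigroup_foldEquiv, freeSemigroup_foldEquiv]
      exact freeGraph.le_topologicalClosure (hgraph t)

lemma mem_closure_freeGraph_iff (p : Energy × Energy) :
    p ∈ freeGraph.topologicalClosure ↔ HasGenerator freeSemigroup p.1 p.2 := by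
  constructor
  · intro hp
    have hcl := isClosed_setOf_hasGenerator isC0Semigroup_freeSemigroup norm_freeSemigroup_le'
    exact hcl.closure_subset_iff.mpr (fun q hq => hasGenerator_of_mem_freeGraph hq) hp
  · intro hp
    obtain ⟨D, hD, hDG⟩ := exists_dense_core
    exact HasGenerator.mem_of_dense isC0Semigroup_freeSemigroup norm_freeSemigroup_le'
      freeGraph.isClosed_topologicalClosure hD hDG hp

lemma isClosable_freeOperator : freeOperator.IsClosable := by
  refine ⟨freeGraph.topologicalClosure.toLinearPMap, ?_⟩
  rw [freeOperator_graph, Submodule.toLinearPMap_graph_eq]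
  rintro ⟨u, v⟩ hp (rfl : u = 0)
  -- The closed graph consists of generator pairs, and limits of difference quotients are unique.
  have h := (mem_closure_freeGraph_iff _).mp hp
  have h0 : HasGenerator freeSemigroup (0 : Energy) 0 := by
    simp [HasGenerator]
  exact h.unique h0

lemma mem_graph_closure_iff (u v : Energy) :
    (u, v) ∈ freeOperator.closure.graph ↔ HasGenerator freeSemigroup u v := by
  rw [← isClosable_freeOperator.graph_closure_eq_closure_graph, freeOperator_graph,
    mem_closure_freeGraph_iff]

lemma isGenerator_freeSemigroup : IsGenerator freeOperator.closure freeSemigroup :=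
  mem_graph_closure_iff

/-- The two semigroups agree on the dense core, hence everywhere. Only the known semigroup has to
satisfy a growth bound; none is assumed of `S`. -/
lemma eq_freeSemigroup {S : ℝ≥0 → Energy →L[ℂ] Energy} (hS : IsC0Semigroup S)
    (hg : IsGenerator freeOperator.closure S) : S = freeSemigroup := by
  have hiff : ∀ u v, HasGenerator S u v ↔ HasGenerator freeSemigroup u v := fun u v =>
    (hg u v).symm.trans (mem_graph_closure_iff u v)
  obtain ⟨D, hD, hDG⟩ := exists_dense_core
  funext t
  refine ContinuousLinearMap.coeFn_injective
    (Continuous.ext_on hD (S t).continuous (freeSemigroup t).continuous fun u hu => ?_)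
  obtain ⟨v, hv, -⟩ := hDG u hu
  exact HasGenerator.orbit_eq isC0Semigroup_freeSemigroup hS norm_freeSemigroup_le'
    (fun a b => (hiff a b).mp) ((hiff u v).mpr hv) t

/-! ### Weak derivatives and primitives -/

/-- On `[a,b]`, the function `F` is a primitive of the integrable function `G`. -/
structure IsPrimitiveOn (a b : ℝ) (F G : ℝ → ℂ) : Prop where
  integrable : IntervalIntegrable G volume a b
  eq_integral : ∀ x ∈ Icc a b, F x = F 0 + ∫ y in 0..x, G y

lemma IsPrimitiveOn.continuousOn {a b : ℝ} {F G : ℝ → ℂ} (h : IsPrimitiveOn a b F G)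
    (ha : a ≤ 0) (hb : 0 ≤ b) : ContinuousOn F (Icc a b) := by
  have h1 : ContinuousOn (fun x => ∫ y in 0..x, G y) (uIcc a b) :=
    intervalIntegral.continuousOn_primitive_interval' h.integrable
      (by rw [uIcc_of_le (ha.trans hb)]; exact ⟨ha, hb⟩)
  rw [uIcc_of_le (ha.trans hb)] at h1
  exact (continuousOn_const.add h1).congr h.eq_integral

lemma intervalIntegrable_of_memLp {G : ℝ → ℂ} (h : MemLp G 2 unitMeasure) :
    IntervalIntegrable G volume 0 1 :=
  (intervalIntegrable_iff_integrableOn_Ioo_of_le zero_le_one).mpr (h.integrable (by norm_num))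

lemma integral_congr_of_ae_unit {G G' : ℝ → ℂ} (h : G =ᵐ[unitMeasure] G') {x : ℝ}
    (hx : x ∈ Icc (0 : ℝ) 1) : ∫ y in 0..x, G y = ∫ y in 0..x, G' y := by
  rw [intervalIntegral.integral_of_le hx.1, intervalIntegral.integral_of_le hx.1,
    integral_Ioc_eq_integral_Ioo, integral_Ioc_eq_integral_Ioo]
  exact integral_congr_ae (ae_restrict_of_ae_restrict_of_subset (Ioo_subset_Ioo_right hx.2) h)

lemma integral_deriv_of_tsupport {φ : ℝ → ℝ} (hφ : ContDiff ℝ ∞ φ) (hs : tsupport φ ⊆ Ioo 0 1)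
    (y : ℝ) : ∫ x in y..1, deriv φ x = -φ y := by
  rw [intervalIntegral.integral_deriv_eq_sub
    (fun x _ => (hφ.differentiable (by simp)).differentiableAt)
    ((hφ.continuous_deriv (by exact_mod_cast le_top)).intervalIntegrable _ _),
    image_eq_zero_of_notMem_tsupport fun h => lt_irrefl _ (hs h).2, zero_sub]

/-- Integration by parts against a test function. -/
lemma IsPrimitiveOn.integral_deriv_smul {F G : ℝ → ℂ} (h : IsPrimitiveOn 0 1 F G) {φ : ℝ → ℝ}
    (hφ : ContDiff ℝ ∞ φ) (hs : tsupport φ ⊆ Ioo 0 1) :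
    ∫ x in Ioo (0 : ℝ) 1, deriv φ x • F x = -∫ x in Ioo (0 : ℝ) 1, φ x • G x := by
  have hd : Continuous (deriv φ) := hφ.continuous_deriv (by exact_mod_cast le_top)
  have hG : Integrable G unitMeasure :=
    (intervalIntegrable_iff_integrableOn_Ioo_of_le zero_le_one).mp h.integrable
  have hd' : Integrable (deriv φ) unitMeasure :=
    (hd.integrableOn_Icc (a := 0) (b := 1)).mono_set Ioo_subset_Icc_self
  have hφ0 : φ 0 = 0 := image_eq_zero_of_notMem_tsupport fun h => lt_irrefl _ (hs h).1
  -- Fubini on the triangle `y < x`: integrating first in `y` produces `F x - F 0`, first in `x`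
  -- produces `-φ y`. The constant `F 0` drops out because `φ'` has integral zero.
  have hint : Integrable (Function.uncurry fun x y : ℝ => (Iio x).indicator
      (fun y => deriv φ x • G y) y) (unitMeasure.prod unitMeasure) := by
    have h1 : Integrable (fun p : ℝ × ℝ => deriv φ p.1 • G p.2)
        (unitMeasure.prod unitMeasure) := hd'.smul_prod hG
    refine (h1.indicator (measurableSet_lt measurable_snd measurable_fst)).congr
      (Eventually.of_forall fun p => ?_)
    simp only [Function.uncurry, indicator_apply, mem_ofPred_eq, mem_Iio]
  have hswap := integral_integral_swap hint
  have e₁ : ∀ x ∈ Ioo (0 : ℝ) 1, ∫ y in Ioo (0 : ℝ) 1, (Iio x).indicator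
      (fun y => deriv φ x • G y) y = deriv φ x • F x - deriv φ x • F 0 := by
    intro x hx
    rw [setIntegral_indicator measurableSet_Iio, Ioo_inter_Iio, min_eq_right hx.2.le,
      integral_smul, h.eq_integral x ⟨hx.1.le, hx.2.le⟩, intervalIntegral.integral_of_le hx.1.le,
      integral_Ioc_eq_integral_Ioo, smul_add, add_sub_cancel_left]
  have e₂ : ∀ y ∈ Ioo (0 : ℝ) 1, ∫ x in Ioo (0 : ℝ) 1, (Iio x).indicator
      (fun y => deriv φ x • G y) y = -(φ y • G y) := by
    intro y hy
    have : ∀ x, (Iio x).indicator (fun y => deriv φ x • G y) y =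
        (Ioi y).indicator (fun x => deriv φ x • G y) x := fun x => by
      simp only [indicator_apply, mem_Iio, mem_Ioi]
    simp only [this]
    rw [setIntegral_indicator measurableSet_Ioi, Ioo_inter_Ioi, max_eq_right hy.1.le,
      integral_smul_const, ← integral_Ioc_eq_integral_Ioo, ← intervalIntegral.integral_of_le hy.2.le,
      integral_deriv_of_tsupport hφ hs, neg_smul]
  rw [setIntegral_congr_fun measurableSet_Ioo e₁, setIntegral_congr_fun measurableSet_Ioo e₂,
    integral_neg] at hswap
  have hzero : ∫ x in Ioo (0 : ℝ) 1, deriv φ x • F 0 = 0 := by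
    rw [integral_smul_const, ← integral_Ioc_eq_integral_Ioo,
      ← intervalIntegral.integral_of_le zero_le_one, integral_deriv_of_tsupport hφ hs, hφ0,
      neg_zero, zero_smul]
  have hF : IntegrableOn (fun x => deriv φ x • F x) (Ioo 0 1) :=
    ((hd.continuousOn.smul (h.continuousOn le_rfl zero_le_one)).integrableOn_Icc).mono_set
      Ioo_subset_Icc_self
  rw [integral_sub hF (hd'.smul_const _), hzero, sub_zero] at hswap
  exact hswap

lemma exists_test_integral_eq_one : ∃ ψ : ℝ → ℝ, ContDiff ℝ ∞ ψ ∧ HasCompactSupport ψ ∧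
    tsupport ψ ⊆ Ioo 0 1 ∧ ∫ x, ψ x = 1 := by
  let b : ContDiffBump (1 / 2 : ℝ) := ⟨1 / 8, 1 / 4, by norm_num, by norm_num⟩
  refine ⟨b.normed volume, b.contDiff_normed, b.hasCompactSupport_normed, ?_, b.integral_normed⟩
  rw [b.tsupport_normed_eq, Real.closedBall_eq_Icc]
  exact Icc_subset_Ioo (by norm_num [b]) (by norm_num [b])

/-- A test function of vanishing integral is the derivative of a test function. -/
lemma exists_test_deriv_eq {χ : ℝ → ℝ} (hχ : ContDiff ℝ ∞ χ) (hc : HasCompactSupport χ)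
    (hs : tsupport χ ⊆ Ioo 0 1) (h0 : ∫ x, χ x = 0) :
    ∃ φ : ℝ → ℝ, ContDiff ℝ ∞ φ ∧ HasCompactSupport φ ∧ tsupport φ ⊆ Ioo 0 1 ∧ deriv φ = χ := by
  rcases (tsupport χ).eq_empty_or_nonempty with he | hne
  · have : χ = 0 := tsupport_eq_empty_iff.mp he
    subst this
    exact ⟨0, contDiff_const, HasCompactSupport.zero, by simp [tsupport], by ext; simp⟩
  obtain ⟨a, ha, hal⟩ := IsCompact.exists_isLeast hc hne
  obtain ⟨b, hb, hbl⟩ := IsCompact.exists_isGreatest hc hne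
  have hz : ∀ x, x ∉ Icc a b → χ x = 0 := fun x hx =>
    image_eq_zero_of_notMem_tsupport fun h => hx ⟨hal h, hbl h⟩
  have hder : ∀ x, HasDerivAt (fun x => ∫ y in 0..x, χ y) (χ x) x := fun x =>
    (hχ.continuous.integral_hasStrictDerivAt 0 x).hasDerivAt
  have hde : deriv (fun x => ∫ y in 0..x, χ y) = χ := funext fun x => (hder x).deriv
  -- Left of the support nothing has been integrated yet; right of it the whole integral, which is
  -- zero, has been collected.
  have hzero : ∀ x, x ∉ Icc a b → ∫ y in 0..x, χ y = 0 := by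
    intro x hx
    rcases lt_or_ge x a with h | h
    · refine (intervalIntegral.integral_congr (g := fun _ => (0 : ℝ)) fun y hy => ?_).trans
        (by simp)
      refine hz y fun hy' => ?_
      have h1 := hy.2
      have h2 : max 0 x < a := max_lt (hs ha).1 h
      exact absurd (h1.trans_lt h2) (not_lt.mpr hy'.1)
    · have hbx : b < x := lt_of_not_ge fun h' => hx ⟨h, h'⟩
      have ha0 := (hs ha).1
      rw [intervalIntegral.integral_of_le (ha0.le.trans h),
        setIntegral_eq_integral_of_forall_compl_eq_zero, h0]
      intro y hy
      refine hz y fun hy' => hy ⟨ha0.trans_le hy'.1, hy'.2.trans hbx.le⟩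
  have hsub : tsupport (fun x => ∫ y in 0..x, χ y) ⊆ Icc a b :=
    closure_minimal (fun x hx => by_contra fun h => hx (hzero x h)) isClosed_Icc
  refine ⟨fun x => ∫ y in 0..x, χ y, ?_, ?_, ?_, hde⟩
  · rw [contDiff_infty_iff_deriv, hde]
    exact ⟨fun x => (hder x).differentiableAt, hχ⟩
  · exact HasCompactSupport.of_support_subset_isCompact isCompact_Icc
      ((subset_tsupport _).trans hsub)
  · exact hsub.trans (Icc_subset_Ioo (hs ha).1 (hs hb).2)

lemma integrable_test_smul {ψ : ℝ → ℝ} (hψ : Continuous ψ) (hc : HasCompactSupport ψ)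
    {h : ℝ → ℂ} (hh : Integrable h unitMeasure) : Integrable (fun x => ψ x • h x) unitMeasure := by
  obtain ⟨C, hC⟩ := hψ.bounded_above_of_compact_support hc
  exact hh.bdd_smul C hψ.aestronglyMeasurable (Eventually.of_forall hC)

/-- The lemma of du Bois-Reymond. -/
lemma ae_eq_const_of_integral_deriv_smul {h : ℝ → ℂ} (hh : Integrable h unitMeasure)
    (H : ∀ φ : ℝ → ℝ, ContDiff ℝ ∞ φ → HasCompactSupport φ → tsupport φ ⊆ Ioo 0 1 →
      ∫ x in Ioo (0 : ℝ) 1, deriv φ x • h x = 0) :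
    ∃ c : ℂ, h =ᵐ[unitMeasure] fun _ => c := by
  obtain ⟨ψ₀, hψ₀, hc₀, hs₀, hi₀⟩ := exists_test_integral_eq_one
  set c : ℂ := ∫ x in Ioo (0 : ℝ) 1, ψ₀ x • h x
  refine ⟨c, ?_⟩
  have hset : ∀ ψ : ℝ → ℝ, tsupport ψ ⊆ Ioo 0 1 → ∀ k : ℝ → ℂ,
      ∫ x in Ioo (0 : ℝ) 1, ψ x • k x = ∫ x, ψ x • k x := fun ψ hs k =>
    setIntegral_eq_integral_of_forall_compl_eq_zero fun x hx => by
      rw [image_eq_zero_of_notMem_tsupport (fun hx' => hx (hs hx')), zero_smul]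
  have hset' : ∀ ψ : ℝ → ℝ, tsupport ψ ⊆ Ioo 0 1 →
      ∫ x in Ioo (0 : ℝ) 1, ψ x = ∫ x, ψ x := fun ψ hs =>
    setIntegral_eq_integral_of_forall_compl_eq_zero fun x hx =>
      image_eq_zero_of_notMem_tsupport (fun hx' => hx (hs hx'))
  have key : ∀ᵐ x : ℝ, x ∈ Ioo (0 : ℝ) 1 → h x - c = 0 := by
    refine isOpen_Ioo.ae_eq_zero_of_integral_contDiff_smul_eq_zero ?_ ?_
    · have hi : IntegrableOn (fun x => h x - c) (Ioo (0 : ℝ) 1) := hh.sub (integrable_const c)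
      exact hi.locallyIntegrableOn
    · intro ψ hψ hc hs
      set m : ℝ := ∫ x, ψ x
      have hψi : Integrable ψ := hψ.continuous.integrable_of_hasCompactSupport hc
      have hψ₀i : Integrable ψ₀ := hψ₀.continuous.integrable_of_hasCompactSupport hc₀
      have hcm : HasCompactSupport fun x => m * ψ₀ x := hc₀.mul_left
      have hsm : tsupport (fun x => m * ψ₀ x) ⊆ Ioo 0 1 :=
        (tsupport_mul_subset_right (f := fun _ => m) (g := ψ₀)).trans hs₀
      -- Subtracting `m ψ₀` removes the mean of `ψ`, so the difference is the derivative of a test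
      -- function and `H` applies.
      obtain ⟨φ, hφ, hφc, hφs, hφd⟩ := exists_test_deriv_eq
        (χ := fun x => ψ x - m * ψ₀ x) (hψ.sub (contDiff_const.mul hψ₀)) (hc.sub hcm)
        ((tsupport_sub ψ fun x => m * ψ₀ x).trans (union_subset hs hsm)) (by
          rw [integral_sub hψi (hψ₀i.const_mul m), integral_const_mul, hi₀, mul_one, sub_self])
      have h1 := H φ hφ hφc hφs
      rw [hφd] at h1
      have h2 : ∫ x in Ioo (0 : ℝ) 1, (ψ x - m * ψ₀ x) • h x =
          (∫ x in Ioo (0 : ℝ) 1, ψ x • h x) - m • c := by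
        have hi : Integrable (fun x => m • ψ₀ x • h x) unitMeasure :=
          (integrable_test_smul hψ₀.continuous hc₀ hh).smul m
        simp only [sub_smul, mul_smul]
        rw [integral_sub (integrable_test_smul hψ.continuous hc hh) hi, integral_smul]
      rw [h2] at h1
      rw [← hset ψ hs]
      simp only [smul_sub]
      rw [integral_sub (integrable_test_smul hψ.continuous hc hh)
        (integrable_test_smul hψ.continuous hc (integrable_const c)), integral_smul_const,
        hset' ψ hs]
      exact h1
  filter_upwards [(ae_restrict_iff' measurableSet_Ioo).mpr key] with x hx
  exact sub_eq_zero.mp hx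

lemma isWeakDeriv_self (f : L2) : IsWeakDeriv 0 f f := by
  intro φ _ _ _
  simp

lemma isWeakDeriv_one_of_isPrimitiveOn {F G : ℝ → ℂ} (h : IsPrimitiveOn 0 1 F G) {f g : L2}
    (hf : f =ᵐ[unitMeasure] F) (hg : g =ᵐ[unitMeasure] G) : IsWeakDeriv 1 f g := by
  intro φ hφ hc hs
  have e₁ : ∫ x in Ioo (0 : ℝ) 1, iteratedDeriv 1 φ x • f x =
      ∫ x in Ioo (0 : ℝ) 1, deriv φ x • F x := integral_congr_ae <| by
    filter_upwards [hf] with x hx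
    rw [hx, iteratedDeriv_one]
  have e₂ : ∫ x in Ioo (0 : ℝ) 1, φ x • g x = ∫ x in Ioo (0 : ℝ) 1, φ x • G x :=
    integral_congr_ae <| by
      filter_upwards [hg] with x hx
      rw [hx]
  rw [e₁, e₂, h.integral_deriv_smul hφ hs]
  ring

/-- The difference between `f` and the primitive of `g` annihilates all derivatives of test
functions, so it is constant by du Bois-Reymond. -/
lemma IsWeakDeriv.exists_primitive {f g : L2} (h : IsWeakDeriv 1 f g) :
    ∃ c : ℂ, f =ᵐ[unitMeasure] fun x => c + ∫ y in 0..x, g y := by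
  have hP : IsPrimitiveOn 0 1 (fun x => ∫ y in 0..x, g y) g :=
    ⟨intervalIntegrable_of_memLp (Lp.memLp g), fun x _ => by simp⟩
  have hPi : Integrable (fun x => ∫ y in 0..x, g y) unitMeasure :=
    ((hP.continuousOn le_rfl zero_le_one).integrableOn_Icc).mono_set Ioo_subset_Icc_self
  have hfi : Integrable f unitMeasure := (Lp.memLp f).integrable (by norm_num)
  obtain ⟨c, hc⟩ := ae_eq_const_of_integral_deriv_smul (hfi.sub hPi) fun φ hφ hφc hs => by
    have hd : Continuous (deriv φ) := hφ.continuous_deriv (by exact_mod_cast le_top)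
    simp only [Pi.sub_apply, smul_sub]
    rw [integral_sub (integrable_test_smul hd hφc.deriv hfi)
      (integrable_test_smul hd hφc.deriv hPi), hP.integral_deriv_smul hφ hs]
    have := h φ hφ hφc hs
    rw [iteratedDeriv_one] at this
    rw [this]
    ring
  refine ⟨c, ?_⟩
  filter_upwards [hc] with x hx
  rw [← hx, Pi.sub_apply, sub_add_cancel]

/-- Use `φ'` as the test function at order `n` and cancel `(-1)^n`. -/
lemma IsWeakDeriv.step {n : ℕ} {f g g' : L2} (h : IsWeakDeriv n f g)
    (h' : IsWeakDeriv (n + 1) f g') : IsWeakDeriv 1 g g' := by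
  intro φ hφ hc hs
  have hd : ContDiff ℝ ∞ (deriv φ) := (contDiff_infty_iff_deriv.mp hφ).2
  have e₁ := h (deriv φ) hd hc.deriv (tsupport_deriv_subset.trans hs)
  have e₂ := h' φ hφ hc hs
  rw [iteratedDeriv_succ', e₁, pow_succ, mul_assoc] at e₂
  rw [iteratedDeriv_one, mul_left_cancel₀ (pow_ne_zero n (by norm_num)) e₂, pow_one]

lemma IsWeakDeriv.succ {n : ℕ} {f g g' : L2} (h : IsWeakDeriv n f g)
    (h' : IsWeakDeriv 1 g g') : IsWeakDeriv (n + 1) f g' := by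
  intro φ hφ hc hs
  have hd : ContDiff ℝ ∞ (deriv φ) := (contDiff_infty_iff_deriv.mp hφ).2
  have e₁ := h (deriv φ) hd hc.deriv (tsupport_deriv_subset.trans hs)
  have e₂ := h' φ hφ hc hs
  rw [iteratedDeriv_one, pow_one] at e₂
  rw [iteratedDeriv_succ', e₁, e₂, pow_succ, mul_assoc]

/-! ### Sobolev functions as chains of primitives. -/

/-- `F 0` represents `f`, and each `F i` with `i < m` is a primitive of `F (i + 1)`, with `F m`
square integrable. -/
structure IsDerivChain (m : ℕ) (f : L2) (F : ℕ → ℝ → ℂ) : Prop where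
  ae_eq : f =ᵐ[unitMeasure] F 0
  primitive : ∀ i < m, IsPrimitiveOn 0 1 (F i) (F (i + 1))
  memLp : MemLp (F m) 2 unitMeasure

lemma MemSobolev.exists_derivChain {m : ℕ} {f : L2} (h : MemSobolev m f) :
    ∃ F, IsDerivChain m f F := by
  choose! g hg using h
  have hg0 : g 0 = f := (hg 0 (Nat.zero_le m)).unique (isWeakDeriv_self f)
  have hex : ∀ i, ∃ c : ℂ, i < m → g i =ᵐ[unitMeasure] fun x => c + ∫ y in 0..x, g (i + 1) y := by
    intro i
    by_cases hi : i < m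
    · obtain ⟨c, hc⟩ := ((hg i hi.le).step (hg (i + 1) hi)).exists_primitive
      exact ⟨c, fun _ => hc⟩
    · exact ⟨0, fun h => absurd h hi⟩
  choose c hc using hex
  -- Below the top order the representative is continuous, being a primitive; at order `m` there is
  -- only a square integrable one.
  let F : ℕ → ℝ → ℂ := fun i => if i < m then fun x => c i + ∫ y in 0..x, g (i + 1) y else g i
  have hF : ∀ i, g i =ᵐ[unitMeasure] F i := fun i => by
    by_cases hi : i < m
    · simpa only [F, if_pos hi] using hc i hi
    · simp only [F, if_neg hi]
      rfl
  refine ⟨F, hg0 ▸ hF 0, fun i hi => ⟨?_, fun x hx => ?_⟩, ?_⟩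
  · exact intervalIntegrable_of_memLp ((memLp_congr_ae (hF (i + 1))).mp (Lp.memLp _))
  · rw [← integral_congr_of_ae_unit (hF (i + 1)) hx]
    simp only [F, if_pos hi, intervalIntegral.integral_same, add_zero]
  · exact (memLp_congr_ae (hF m)).mp (Lp.memLp _)

namespace IsDerivChain

variable {m : ℕ} {f : L2} {F : ℕ → ℝ → ℂ}

lemma memLp_of_le (h : IsDerivChain m f F) {i : ℕ} (hi : i ≤ m) : MemLp (F i) 2 unitMeasure := by
  rcases hi.eq_or_lt with rfl | hi
  · exact h.memLp
  · have hc := (h.primitive i hi).continuousOn le_rfl zero_le_one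
    obtain ⟨C, hC⟩ := isCompact_Icc.exists_bound_of_continuousOn hc
    refine MemLp.of_bound ((hc.mono Ioo_subset_Icc_self).aestronglyMeasurable measurableSet_Ioo)
      C ?_
    filter_upwards [ae_unit_mem] with x hx
    exact hC x (Ioo_subset_Icc_self hx)

lemma isWeakDeriv (h : IsDerivChain m f F) {i : ℕ} (hi : i ≤ m) {g : L2}
    (hg : g =ᵐ[unitMeasure] F i) : IsWeakDeriv i f g := by
  induction i generalizing g with
  | zero =>
    rw [show g = f from Lp.ext (hg.trans h.ae_eq.symm)]
    exact isWeakDeriv_self f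
  | succ i ih =>
    have hi' : i ≤ m := (Nat.le_succ i).trans hi
    have hmem := h.memLp_of_le hi'
    exact (ih hi' hmem.coeFn_toLp).succ
      (isWeakDeriv_one_of_isPrimitiveOn (h.primitive i hi) hmem.coeFn_toLp hg)

lemma coeFn_eq (h : IsDerivChain m f F) {i : ℕ} (hi : i ≤ m) {g : L2} (hg : IsWeakDeriv i f g) :
    g =ᵐ[unitMeasure] F i := by
  have hmem := h.memLp_of_le hi
  rw [hg.unique (h.isWeakDeriv hi hmem.coeFn_toLp)]
  exact hmem.coeFn_toLp

lemma memSobolev (h : IsDerivChain m f F) : MemSobolev m f := fun _ hn =>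
  ⟨_, h.isWeakDeriv hn (h.memLp_of_le hn).coeFn_toLp⟩

/-- Continuous representatives agree on the open interval, hence at zero. Strict inequality is
essential: `F m` need not be continuous. -/
lemma derivVanishesAtZero_iff (h : IsDerivChain m f F) {i : ℕ} (hi : i < m) :
    DerivVanishesAtZero i f ↔ F i 0 = 0 := by
  have hc := (h.primitive i hi).continuousOn le_rfl zero_le_one
  constructor
  · rintro ⟨g, hg, p, hp, hgp, hp0⟩
    have heq : EqOn p (F i) (Ioo 0 1) :=
      eqOn_of_ae_eq hp hc (hgp.symm.trans (h.coeFn_eq hi.le hg))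
    have hcl : EqOn p (F i) (Icc 0 1) := by
      refine heq.of_subset_closure hp hc Ioo_subset_Icc_self ?_
      rw [closure_Ioo (by norm_num)]
    rw [← hcl ⟨le_rfl, zero_le_one⟩, hp0]
  · intro h0
    have hmem := h.memLp_of_le hi.le
    exact ⟨_, h.isWeakDeriv hi.le hmem.coeFn_toLp, F i, hc, hmem.coeFn_toLp, h0⟩

end IsDerivChain

/-! ### Invariance of the Sobolev spaces -/

/-- The extension of `f₁ + f₂` to the symmetric interval in which `f₁` and `f₂` are continued with
the parities of the `i`-th derivatives of an odd and an even function. -/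
def signedGlue (i : ℕ) (f₁ f₂ : ℝ → ℂ) (x : ℝ) : ℂ :=
  if 0 ≤ x then f₁ x + f₂ x else (-1) ^ i * (f₂ (-x) - f₁ (-x))

/-- At even order the parities are those of the original pair, so the free semigroup itself acts on
these derivatives; at odd order the two parities are swapped. -/
lemma signedGlue_of_even {i : ℕ} (hi : Even i) (f₁ f₂ : ℝ → ℂ) :
    signedGlue i f₁ f₂ = glue f₁ f₂ := by
  funext x
  rw [signedGlue, glue, hi.neg_one_pow, one_mul]

/-- The jump at zero is `2 F₁(0)` for even `i` and `2 F₂(0)` for odd `i`. These are precisely the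
boundary values prescribed in `H²ᵏ`, so no point mass appears when differentiating across zero. -/
lemma IsPrimitiveOn.signedGlue {F₁ F₂ G₁ G₂ : ℝ → ℂ} (h₁ : IsPrimitiveOn 0 1 F₁ G₁)
    (h₂ : IsPrimitiveOn 0 1 F₂ G₂) {i : ℕ} (he : Even i → F₁ 0 = 0) (ho : Odd i → F₂ 0 = 0) :
    IsPrimitiveOn (-1) 1 (signedGlue i F₁ F₂) (signedGlue (i + 1) G₁ G₂) := by
  have hpos : ∀ y, 0 < y → FreeWave.signedGlue (i + 1) G₁ G₂ y = G₁ y + G₂ y :=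
    fun y hy => if_pos hy.le
  have hneg : ∀ y, y < 0 → FreeWave.signedGlue (i + 1) G₁ G₂ y =
      (-1) ^ (i + 1) * (G₂ (-y) - G₁ (-y)) := fun y hy => if_neg hy.not_ge
  have hsum : IntervalIntegrable (fun y => G₁ y + G₂ y) volume 0 1 :=
    h₁.integrable.add h₂.integrable
  have hdiff : IntervalIntegrable (fun y => (-1 : ℂ) ^ (i + 1) * (G₂ y - G₁ y)) volume 0 1 :=
    (h₂.integrable.sub h₁.integrable).const_mul _
  have hsub : ∀ {x : ℝ}, 0 ≤ x → x ≤ 1 → uIcc 0 x ⊆ uIcc 0 1 := fun h0 h1 => by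
    rw [uIcc_of_le h0, uIcc_of_le zero_le_one]
    exact Icc_subset_Icc_right h1
  refine ⟨?_, fun x hx => ?_⟩
  · refine IntervalIntegrable.trans (b := 0) ?_ ?_
    · have h := ((IntervalIntegrable.iff_comp_neg).mp hdiff).symm
      rw [neg_zero] at h
      refine h.congr_uIoo fun y hy => ?_
      rw [uIoo_of_le (by norm_num)] at hy
      exact (hneg y hy.2).symm
    · refine hsum.congr_uIoo fun y hy => ?_
      rw [uIoo_of_le zero_le_one] at hy
      exact (hpos y hy.1).symm
  have h0 : FreeWave.signedGlue i F₁ F₂ 0 = F₁ 0 + F₂ 0 := if_pos le_rfl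
  rcases lt_or_ge x 0 with hx0 | hx0
  · have hx' : -x ∈ Icc (0 : ℝ) 1 := ⟨by linarith, by linarith [hx.1]⟩
    have hint : ∫ y in 0..x, FreeWave.signedGlue (i + 1) G₁ G₂ y =
        -∫ y in 0..(-x), (-1) ^ (i + 1) * (G₂ y - G₁ y) := by
      have := intervalIntegral.integral_comp_neg (a := x) (b := 0)
        (fun y => (-1 : ℂ) ^ (i + 1) * (G₂ y - G₁ y))
      rw [neg_zero] at this
      rw [← this, intervalIntegral.integral_symm]
      congr 1
      rw [intervalIntegral.integral_of_le hx0.le, intervalIntegral.integral_of_le hx0.le,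
        integral_Ioc_eq_integral_Ioo, integral_Ioc_eq_integral_Ioo]
      exact setIntegral_congr_fun measurableSet_Ioo fun y hy => hneg y hy.2
    rw [h0, hint, intervalIntegral.integral_const_mul, intervalIntegral.integral_sub
      (h₂.integrable.mono_set (hsub hx'.1 hx'.2)) (h₁.integrable.mono_set (hsub hx'.1 hx'.2))]
    have k₁ := h₁.eq_integral _ hx'
    have k₂ := h₂.eq_integral _ hx'
    have hx2 : FreeWave.signedGlue i F₁ F₂ x = (-1) ^ i * (F₂ (-x) - F₁ (-x)) :=
      if_neg hx0.not_ge
    rw [hx2, k₁, k₂, pow_succ]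
    rcases i.even_or_odd with hi | hi
    · rw [he hi, hi.neg_one_pow]
      ring
    · rw [ho hi, hi.neg_one_pow]
      ring
  · have hint : ∫ y in 0..x, FreeWave.signedGlue (i + 1) G₁ G₂ y =
        ∫ y in 0..x, (G₁ y + G₂ y) :=
      intervalIntegral.integral_congr fun y hy => by
        rw [uIcc_of_le hx0] at hy
        exact if_pos hy.1
    have hx2 : FreeWave.signedGlue i F₁ F₂ x = F₁ x + F₂ x := if_pos hx0
    rw [h0, hint, hx2, intervalIntegral.integral_add (h₁.integrable.mono_set (hsub hx0 hx.2))
      (h₂.integrable.mono_set (hsub hx0 hx.2)), h₁.eq_integral x ⟨hx0, hx.2⟩,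
      h₂.eq_integral x ⟨hx0, hx.2⟩]
    ring

lemma IsPrimitiveOn.const_mul {a b : ℝ} {F G : ℝ → ℂ} (h : IsPrimitiveOn a b F G) (c : ℂ) :
    IsPrimitiveOn a b (fun x => c * F x) (fun x => c * G x) := by
  refine ⟨h.integrable.const_mul c, fun x hx => ?_⟩
  rw [intervalIntegral.integral_const_mul, h.eq_integral x hx, mul_add]

lemma IsPrimitiveOn.comp_flow {F G : ℝ → ℂ} (h : IsPrimitiveOn (-1) 1 F G) {t : ℝ} (ht : 0 ≤ t) :
    IsPrimitiveOn (-1) 1 (fun x => F (flow t x))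
      (fun x => Real.exp (-t) * G (flow t x)) := by
  have he := Real.exp_pos (-t)
  have hmono : ∀ {x y : ℝ}, x ≤ y → flow t x ≤ flow t y := fun hxy => by
    rw [flow_eq, flow_eq]
    gcongr
  have hI : ∀ x ∈ Icc (-1 : ℝ) 1, IntervalIntegrable G volume 0 (flow t x) := fun x hx => by
    refine h.integrable.mono_set ?_
    rw [uIcc_of_le (by norm_num : (-1 : ℝ) ≤ 1)]
    exact ordConnected_Icc.uIcc_subset ⟨by norm_num, by norm_num⟩ (flow_mem_Icc ht hx)
  have h0 : (0 : ℝ) ∈ Icc (-1 : ℝ) 1 := ⟨by norm_num, by norm_num⟩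
  have h1 : (1 : ℝ) ∈ Icc (-1 : ℝ) 1 := ⟨by norm_num, by norm_num⟩
  have hn : (-1 : ℝ) ∈ Icc (-1 : ℝ) 1 := ⟨by norm_num, by norm_num⟩
  refine ⟨?_, fun x hx => ?_⟩
  · refine IntervalIntegrable.const_mul ?_ _
    have hG : IntervalIntegrable G volume (flow t (-1)) (flow t 1) :=
      (hI _ hn).symm.trans (hI _ h1)
    have h2 := (hG.comp_add_right (1 - Real.exp (-t))).comp_mul_left (c := Real.exp (-t))
    simp only [flow_eq, add_sub_cancel_right, mul_div_cancel_left₀ _ he.ne'] at h2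
    refine h2.congr_uIoo fun y _ => ?_
    simp only [flow_eq]
  · have hsubst := intervalIntegral.integral_comp_mul_add (a := 0) (b := x) G he.ne'
      (1 - Real.exp (-t))
    have e : ∫ y in 0..x, (Real.exp (-t) : ℂ) * G (flow t y) =
        ∫ y in (flow t 0)..(flow t x), G y := by
      rw [intervalIntegral.integral_const_mul]
      simp only [flow_eq]
      rw [hsubst, ← Complex.real_smul, smul_inv_smul₀ he.ne']
    rw [e, ← intervalIntegral.integral_interval_sub_left (hI x hx) (hI 0 h0),
      h.eq_integral _ (flow_mem_Icc ht hx), h.eq_integral _ (flow_mem_Icc ht h0)]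
    ring

/-- Differentiating the reflected term flips its sign, which is why the parity alternates along a
chain. -/
lemma IsPrimitiveOn.fold {F G : ℝ → ℂ} (h : IsPrimitiveOn (-1) 1 F G) (a : ℂ) :
    IsPrimitiveOn 0 1 (fun x => (F x + a * F (-x)) / 2) (fun x => (G x - a * G (-x)) / 2) := by
  have hsub : ∀ {x : ℝ}, x ∈ Icc (0 : ℝ) 1 → IntervalIntegrable G volume 0 x ∧
      IntervalIntegrable (fun y => G (-y)) volume 0 x := fun {x} hx => by
    have hu : uIcc (-1 : ℝ) 1 = Icc (-1) 1 := uIcc_of_le (by norm_num)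
    have h0 : (0 : ℝ) ∈ Icc (-1 : ℝ) 1 := ⟨by norm_num, by norm_num⟩
    constructor
    · refine h.integrable.mono_set ?_
      rw [hu]
      exact ordConnected_Icc.uIcc_subset h0 ⟨by linarith [hx.1], hx.2⟩
    · have : IntervalIntegrable G volume 0 (-x) := by
        refine h.integrable.mono_set ?_
        rw [hu]
        exact ordConnected_Icc.uIcc_subset h0 ⟨by linarith [hx.2], by linarith [hx.1]⟩
      have h2 := (IntervalIntegrable.iff_comp_neg).mp this
      rwa [neg_zero, neg_neg] at h2
  refine ⟨?_, fun x hx => ?_⟩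
  · obtain ⟨k₁, k₂⟩ := hsub (x := 1) ⟨zero_le_one, le_rfl⟩
    exact (k₁.sub (k₂.const_mul a)).div_const 2
  · obtain ⟨k₁, k₂⟩ := hsub hx
    rw [intervalIntegral.integral_div, intervalIntegral.integral_sub k₁ (k₂.const_mul a),
      intervalIntegral.integral_const_mul, intervalIntegral.integral_comp_neg, neg_zero,
      intervalIntegral.integral_symm 0 (-x), h.eq_integral x ⟨by linarith [hx.1], hx.2⟩,
      h.eq_integral (-x) ⟨by linarith [hx.2], by linarith [hx.1]⟩]
    ring

/-! ### Derivatives of the evolved state. -/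

/-- The `i`-th derivative of the unfolded state, transported along the flow. -/
def flowDeriv (t : ℝ) (F₁ F₂ : ℕ → ℝ → ℂ) (i : ℕ) (x : ℝ) : ℂ :=
  (Real.exp (-t) : ℂ) ^ i * signedGlue i (F₁ i) (F₂ i) (flow t x)

section Invariance

variable {k : ℕ} {u : Energy} {F₁ F₂ : ℕ → ℝ → ℂ}

lemma isPrimitiveOn_flowDeriv (h₁ : IsDerivChain (2 * k) u.fst F₁)
    (h₂ : IsDerivChain (2 * k) u.snd F₂)
    (hb : ∀ j < k, F₁ (2 * j) 0 = 0 ∧ F₂ (2 * j + 1) 0 = 0) {t : ℝ} (ht : 0 ≤ t) {i : ℕ}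
    (hi : i < 2 * k) :
    IsPrimitiveOn (-1) 1 (flowDeriv t F₁ F₂ i) (flowDeriv t F₁ F₂ (i + 1)) := by
  have h := (h₁.primitive i hi).signedGlue (h₂.primitive i hi) (i := i) (fun he => by
    obtain ⟨j, rfl⟩ := even_iff_two_dvd.mp he
    exact (hb j (by omega)).1) (fun ho => by
    obtain ⟨j, rfl⟩ := ho
    exact (hb j (by omega)).2)
  have h' := (h.comp_flow ht).const_mul ((Real.exp (-t) : ℂ) ^ i)
  unfold flowDeriv
  simpa only [pow_succ, mul_assoc] using h'

lemma coeFn_freeSemigroup_of_ae_eq {v : Energy} {G₁ G₂ : ℝ → ℂ} (h₁ : v.fst =ᵐ[unitMeasure] G₁)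
    (h₂ : v.snd =ᵐ[unitMeasure] G₂) (t : ℝ≥0) :
    (freeSemigroup t v).fst =ᵐ[unitMeasure]
        (fun x => (glue G₁ G₂ (flow t x) - glue G₁ G₂ (flow t (-x))) / 2) ∧
      (freeSemigroup t v).snd =ᵐ[unitMeasure]
        (fun x => (glue G₁ G₂ (flow t x) + glue G₁ G₂ (flow t (-x))) / 2) := by
  have hv := coeFn_unfold_of_ae_eq h₁ h₂
  rw [freeSemigroup_apply, foldEquiv_symm_apply]
  exact ⟨coeFn_foldEquiv_fst (coeFn_flowOperator t hv),
    coeFn_foldEquiv_snd (coeFn_flowOperator t hv)⟩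

/-- The components of the derivatives of the evolved state. -/
def evolved (t : ℝ) (F₁ F₂ : ℕ → ℝ → ℂ) (a : ℂ) (i : ℕ) (x : ℝ) : ℂ :=
  (flowDeriv t F₁ F₂ i x + a * (-1) ^ i * flowDeriv t F₁ F₂ i (-x)) / 2

lemma isPrimitiveOn_evolved (h₁ : IsDerivChain (2 * k) u.fst F₁)
    (h₂ : IsDerivChain (2 * k) u.snd F₂)
    (hb : ∀ j < k, F₁ (2 * j) 0 = 0 ∧ F₂ (2 * j + 1) 0 = 0) {t : ℝ} (ht : 0 ≤ t) (a : ℂ) {i : ℕ}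
    (hi : i < 2 * k) :
    IsPrimitiveOn 0 1 (evolved t F₁ F₂ a i) (evolved t F₁ F₂ a (i + 1)) := by
  have h := (isPrimitiveOn_flowDeriv h₁ h₂ hb ht hi).fold (a * (-1) ^ i)
  unfold evolved
  convert h using 3 with x
  rw [pow_succ]
  ring

/-- This carries the commutation relation `D^i S(t) = e^{-it} S(t) D^i` for even `i`; the signs `a =
-1` and `a = 1` select the odd and the even component. -/
lemma coeFn_evolved {v : Energy} {i : ℕ} (hi : Even i) (h₁ : v.fst =ᵐ[unitMeasure] F₁ i)
    (h₂ : v.snd =ᵐ[unitMeasure] F₂ i) (t : ℝ≥0) :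
    ((Real.exp (-t) : ℂ) ^ i • freeSemigroup t v).fst =ᵐ[unitMeasure] evolved t F₁ F₂ (-1) i ∧
      ((Real.exp (-t) : ℂ) ^ i • freeSemigroup t v).snd =ᵐ[unitMeasure]
        evolved t F₁ F₂ 1 i := by
  obtain ⟨k₁, k₂⟩ := coeFn_freeSemigroup_of_ae_eq h₁ h₂ t
  constructor
  · filter_upwards [k₁, Lp.coeFn_smul ((Real.exp (-t) : ℂ) ^ i) (freeSemigroup t v).fst]
      with x hx hs
    refine hs.trans ?_
    rw [Pi.smul_apply, hx, smul_eq_mul, evolved, flowDeriv, flowDeriv, signedGlue_of_even hi,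
      hi.neg_one_pow]
    ring
  · filter_upwards [k₂, Lp.coeFn_smul ((Real.exp (-t) : ℂ) ^ i) (freeSemigroup t v).snd]
      with x hx hs
    refine hs.trans ?_
    rw [Pi.smul_apply, hx, smul_eq_mul, evolved, flowDeriv, flowDeriv, signedGlue_of_even hi,
      hi.neg_one_pow]
    ring

lemma isDerivChain_evolved (h₁ : IsDerivChain (2 * k) u.fst F₁)
    (h₂ : IsDerivChain (2 * k) u.snd F₂)
    (hb : ∀ j < k, F₁ (2 * j) 0 = 0 ∧ F₂ (2 * j + 1) 0 = 0) (t : ℝ≥0) :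
    IsDerivChain (2 * k) (freeSemigroup t u).fst (evolved t F₁ F₂ (-1)) ∧
      IsDerivChain (2 * k) (freeSemigroup t u).snd (evolved t F₁ F₂ 1) := by
  have h0 := coeFn_evolved Even.zero h₁.ae_eq h₂.ae_eq t
  rw [pow_zero, one_smul] at h0
  -- Evolving the pair of top derivatives inside the energy space yields the square integrability
  -- that a chain demands at its last level.
  have htop := coeFn_evolved (v := WithLp.toLp 2 (h₁.memLp.toLp, h₂.memLp.toLp))
    (even_two_mul k) h₁.memLp.coeFn_toLp h₂.memLp.coeFn_toLp t
  exact ⟨⟨h0.1, fun i hi => isPrimitiveOn_evolved h₁ h₂ hb t.2 _ hi,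
      (memLp_congr_ae htop.1).mp (Lp.memLp _)⟩,
    ⟨h0.2, fun i hi => isPrimitiveOn_evolved h₁ h₂ hb t.2 _ hi,
      (memLp_congr_ae htop.2).mp (Lp.memLp _)⟩⟩

end Invariance

lemma exists_derivChain_of_mem {k : ℕ} {u : Energy} (hu : u ∈ sobolevSubmodule k) :
    ∃ F₁ F₂, IsDerivChain (2 * k) u.fst F₁ ∧ IsDerivChain (2 * k) u.snd F₂ ∧
      ∀ j < k, F₁ (2 * j) 0 = 0 ∧ F₂ (2 * j + 1) 0 = 0 := by
  obtain ⟨hu₁, hu₂, hu₃⟩ := hu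
  obtain ⟨F₁, h₁⟩ := hu₁.exists_derivChain
  obtain ⟨F₂, h₂⟩ := hu₂.exists_derivChain
  exact ⟨F₁, F₂, h₁, h₂, fun j hj =>
    ⟨(h₁.derivVanishesAtZero_iff (by omega)).mp (hu₃ j hj).1,
      (h₂.derivVanishesAtZero_iff (by omega)).mp (hu₃ j hj).2⟩⟩

lemma freeSemigroup_mem_sobolevSubmodule {k : ℕ} (t : ℝ≥0) {u : Energy}
    (hu : u ∈ sobolevSubmodule k) : freeSemigroup t u ∈ sobolevSubmodule k := by
  obtain ⟨F₁, F₂, h₁, h₂, hb⟩ := exists_derivChain_of_mem hu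
  obtain ⟨k₁, k₂⟩ := isDerivChain_evolved h₁ h₂ hb t
  refine ⟨k₁.memSobolev, k₂.memSobolev, fun j hj =>
    ⟨(k₁.derivVanishesAtZero_iff (by omega)).mpr ?_,
      (k₂.derivVanishesAtZero_iff (by omega)).mpr ?_⟩⟩
  -- The boundary conditions persist by parity: even derivatives of an odd function and odd
  -- derivatives of an even one vanish at the origin.
  · simp [evolved]
  · simp [evolved, pow_succ]

/-! ### The restricted semigroup on the Sobolev spaces. -/

namespace SobolevSpace

variable {k : ℕ}

/-- The restriction of the free semigroup to `H²ᵏ`, as a linear map. -/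
def evolve (k : ℕ) (t : ℝ≥0) : SobolevSpace k →ₗ[ℂ] SobolevSpace k :=
  (freeSemigroup t).toLinearMap.restrict fun _ hu => freeSemigroup_mem_sobolevSubmodule t hu

lemma incl_evolve (t : ℝ≥0) (u : SobolevSpace k) :
    incl k (evolve k t u) = freeSemigroup t (incl k u) := rfl

lemma topDeriv_evolve (t : ℝ≥0) (u : SobolevSpace k) :
    topDeriv (evolve k t u) = (Real.exp (-t) : ℂ) ^ (2 * k) • freeSemigroup t (topDeriv u) := by
  obtain ⟨F₁, F₂, h₁, h₂, hb⟩ := exists_derivChain_of_mem (incl_mem u)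
  obtain ⟨k₁, k₂⟩ := isDerivChain_evolved h₁ h₂ hb t
  have h := coeFn_evolved (even_two_mul k) (h₁.coeFn_eq le_rfl (topDeriv_spec u).1)
    (h₂.coeFn_eq le_rfl (topDeriv_spec u).2) t
  exact topDeriv_eq (k₁.isWeakDeriv le_rfl h.1) (k₂.isWeakDeriv le_rfl h.2)

lemma norm_sq_eq (u : SobolevSpace k) : ‖u‖ ^ 2 = ‖incl k u‖ ^ 2 + ‖topDeriv u‖ ^ 2 := by
  rw [← inner_self_eq_norm_sq (𝕜 := ℂ), ← inner_self_eq_norm_sq (𝕜 := ℂ) (incl k u),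
    ← inner_self_eq_norm_sq (𝕜 := ℂ) (topDeriv u), ← map_add]
  rfl

lemma norm_evolve_le (t : ℝ≥0) (u : SobolevSpace k) :
    ‖evolve k t u‖ ≤ Real.exp ((t : ℝ) / 2) * ‖u‖ := by
  refine (sq_le_sq₀ (norm_nonneg _) (by positivity)).mp ?_
  rw [norm_sq_eq, mul_pow, norm_sq_eq, mul_add, ← mul_pow, ← mul_pow, incl_evolve,
    topDeriv_evolve, norm_smul]
  have he : ‖(Real.exp (-t) : ℂ) ^ (2 * k)‖ ≤ 1 := by
    rw [norm_pow, Complex.norm_real, Real.norm_of_nonneg (Real.exp_pos _).le]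
    -- The damping `e^{-2kt}` of the top derivative is simply discarded, leaving the same bound for
    -- both parts of the norm.
    exact pow_le_one₀ (Real.exp_pos _).le (Real.exp_le_one_iff.mpr (neg_nonpos.mpr t.2))
  refine add_le_add (pow_le_pow_left₀ (norm_nonneg _) (norm_freeSemigroup_le t _) 2)
    (pow_le_pow_left₀ (by positivity) ?_ 2)
  exact (mul_le_of_le_one_left (norm_nonneg _) he).trans (norm_freeSemigroup_le t _)

/-- The restriction of the free semigroup to `H²ᵏ`. -/
def semigroup (k : ℕ) (t : ℝ≥0) : SobolevSpace k →L[ℂ] SobolevSpace k :=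
  (evolve k t).mkContinuous (Real.exp ((t : ℝ) / 2)) (norm_evolve_le t)

lemma incl_semigroup (t : ℝ≥0) (u : SobolevSpace k) :
    incl k (semigroup k t u) = freeSemigroup t (incl k u) := rfl

lemma topDeriv_semigroup (t : ℝ≥0) (u : SobolevSpace k) :
    topDeriv (semigroup k t u) = (Real.exp (-t) : ℂ) ^ (2 * k) • freeSemigroup t (topDeriv u) :=
  topDeriv_evolve t u

lemma topDeriv_sub (u v : SobolevSpace k) : topDeriv (u - v) = topDeriv u - topDeriv v := by
  rw [sub_eq_add_neg, ← neg_one_smul ℂ v, topDeriv_add, topDeriv_smul, neg_one_smul,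
    ← sub_eq_add_neg]

lemma isC0Semigroup_semigroup (k : ℕ) : IsC0Semigroup (semigroup k) where
  map_zero := by
    ext1 u
    refine incl_injective ?_
    rw [incl_semigroup, isC0Semigroup_freeSemigroup.map_zero]
    rfl
  map_add s t := by
    ext1 u
    refine incl_injective ?_
    rw [ContinuousLinearMap.comp_apply, incl_semigroup, incl_semigroup, incl_semigroup,
      isC0Semigroup_freeSemigroup.map_add]
    rfl
  strongly_continuous u := by
    refine continuous_iff_continuousAt.mpr fun t => ?_
    refine tendsto_iff_norm_sub_tendsto_zero.mpr ?_
    have h₁ : Tendsto (fun s : ℝ≥0 => freeSemigroup s (incl k u)) (𝓝 t)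
        (𝓝 (freeSemigroup t (incl k u))) :=
      (isC0Semigroup_freeSemigroup.strongly_continuous _).tendsto t
    have he : Continuous fun s : ℝ≥0 => (Real.exp (-s) : ℂ) ^ (2 * k) :=
      (Complex.continuous_ofReal.comp
        (Real.continuous_exp.comp NNReal.continuous_coe.neg)).pow _
    have hc := he.smul (isC0Semigroup_freeSemigroup.strongly_continuous (topDeriv u))
    -- The squared norm splits into the state and its top derivative; both move continuously in the
    -- energy space, the latter as a scalar function of time times a free orbit.
    have h₂ := ((tendsto_iff_norm_sub_tendsto_zero.mp h₁).pow 2).add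
      ((tendsto_iff_norm_sub_tendsto_zero.mp (hc.tendsto t)).pow 2)
    have h₃ := h₂.sqrt
    simp only [ne_eq, OfNat.ofNat_ne_zero, not_false_eq_true, zero_pow, add_zero,
      Real.sqrt_zero] at h₃
    refine h₃.congr fun s => ?_
    rw [← Real.sqrt_sq (norm_nonneg (semigroup k s u - semigroup k t u)), norm_sq_eq, map_sub,
      topDeriv_sub, incl_semigroup, incl_semigroup, topDeriv_semigroup, topDeriv_semigroup]
    rfl

end SobolevSpace

end FreeWave

end

theorem lemma3p3 :
    freeOperator.IsClosable ∧
    (∃! S : ℝ≥0 → Energy →L[ℂ] Energy,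
      IsC0Semigroup S ∧ IsGenerator freeOperator.closure S) ∧
    ∀ S : ℝ≥0 → Energy →L[ℂ] Energy,
      IsC0Semigroup S → IsGenerator freeOperator.closure S →
      ∀ k : ℕ,
        (∀ (τ : ℝ≥0), ∀ u ∈ sobolevSubmodule k, S τ u ∈ sobolevSubmodule k) ∧
        ∃ T : ℝ≥0 → SobolevSpace k →L[ℂ] SobolevSpace k,
          IsC0Semigroup T ∧
          (∀ (τ : ℝ≥0) (u : SobolevSpace k),
            SobolevSpace.incl k (T τ u) = S τ (SobolevSpace.incl k u)) ∧
          ∀ (τ : ℝ≥0) (u : SobolevSpace k), ‖T τ u‖ ≤ Real.exp ((τ : ℝ) / 2) * ‖u‖ := by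
  refine ⟨isClosable_freeOperator, ⟨freeSemigroup, ⟨isC0Semigroup_freeSemigroup,
    isGenerator_freeSemigroup⟩, fun S hS => eq_freeSemigroup hS.1 hS.2⟩, ?_⟩
  intro S hS hg k
  obtain rfl := eq_freeSemigroup hS hg
  exact ⟨fun τ u hu => freeSemigroup_mem_sobolevSubmodule τ hu, SobolevSpace.semigroup k,
    SobolevSpace.isC0Semigroup_semigroup k, SobolevSpace.incl_semigroup,
    SobolevSpace.norm_evolve_le⟩
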